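/- **Conventions.** Operations are quantum operations (completely positive, trace preserving maps given by Kraus operators) and may change the Hilbert space they act on. Fix a class $\mathcal B$ of quantum systems that contains all finite-dimensional systems and is closed under composition (for example all finite-dimensional systems, or all systems); $B$ always denotes a system of this class. An *entanglement monotone* $E$ is a nonnegative real function of the states of finite-dimensional bipartite systems $A_1A_2$ that vanishes for separable states and is nonincreasing under (finitely many rounds of) local operations and classical communication; it is *convex* if $E(t\rho+(1-t)\sigma)\le tE(\rho)+(1-t)E(\sigma)$ for $t\in[0,1]$. A *correlation monotone* $C$ is a nonnegative real function of the states of systems $AB$, with $A$ finite-dimensional, that vanishes for product states and is nonincreasing under operations on $A$ alone and under operations on $B$ alone. Let $\mathcal E_d$ be the set of probability vectors, in decreasing order, with at most $d$ positive components (padded with zeros when vectors of different length are compared). The *pure-state function* $f$ of $C$ assigns to a probability vector $\boldsymbol p$ the value $f(\boldsymbol p)=C(|\psi\rangle\langle\psi|)$, where $|\psi\rangle=\sum_i\sqrt{p_i}\,|i\rangle|i\rangle$ (all pure states with Schmidt coefficients $\sqrt{p_i}$ give the same value). Let $c_d=\sup_{\mathcal E_d}f$. **Theorem.** Let $E$ be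 a convex entanglement monotone and $C$ a correlation monotone with pure-state function $f$. There are numbers $e_{d_1}$, depending only on $E$ and $d_1$, such that, for all integers $d_2\ge d_1\ge 1$, $e_{d_1}$ is the largest value of $E$ on the pure states of $\mathcal H_{d_1}\otimes\mathcal H_{d_2}$, and also the largest value of $E$ on all the states of $\mathcal H_{d_1}\otimes\mathcal H_{d_2}$. Moreover, for all integers $d_2\ge d_1\ge1$, with $d=d_1d_2$, if $f$ is continuous on $\mathcal E_d$, then there is a real function $\xi_{d_1,d_2}$, nonincreasing on $[0,c_d]$, with $\xi_{d_1,d_2}(0)=e_{d_1}$, such that the following hold, where $A$ has the Hilbert space $\mathcal H_{d_1}\otimes\mathcal H_{d_2}$ and $\rho_A=\operatorname{tr}_B\rho$. 1. For every system $B$ and every state $\rho$ of $AB$, $C(\rho)\in[0,c_d]$ and $E(\rho_A)\le\xi_{d_1,d_2}[C(\rho)]$. 2. For every $x\in[0,c_d]$ and every $\eta>0$, there are a system $B$ and a state $\rho$ of $AB$ such that $C(\rho)=x$ and $\xi_{d_1,d_2}[C(\rho)]-E(\rho_A)<\eta$. 3. If $f(1/d,\ldots,1/d)=c_d$ and $f(\boldsymbol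 p)<c_d$ for every other $\boldsymbol p\in\mathcal E_d$, then $\xi_{d_1,d_2}(c_d)=0$. -/

import Mathlib

open scoped Matrix Kronecker ComplexOrder

noncomputable section

namespace QCorr

/-! ### Quantum states -/

/-- A density operator on the Hilbert space `ℓ²(ι)`, given by its matrix in the canonical basis:
a positive semidefinite matrix whose diagonal sums to one. For finite `ι` this is a density matrix.
A composite system with local Hilbert spaces `ℓ²(α)` and `ℓ²(κ)` has the index type `α × κ`. -/
@[ext]
structure State (ι : Type) where
  mat : Matrix ι ι ℂ
  posSemidef : mat.PosSemidef
  hasSum_diag : HasSum (fun i => mat i i) 1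

/-- `ρ = |ψ⟩⟨ψ|` for some vector `ψ`. -/
def State.IsPure {ι : Type} (ρ : State ι) : Prop :=
  ∃ ψ : ι → ℂ, ρ.mat = Matrix.vecMulVec ψ (star ψ)

theorem State.norm_le {ι : Type} (ρ : State ι) (i j : ι) :
    ‖ρ.mat i j‖ ≤ ‖ρ.mat i i‖ + ‖ρ.mat j j‖ := by
  have h := (ρ.posSemidef.submatrix ![i, j]).det_nonneg
  rw [Matrix.det_fin_two] at h
  simp only [Matrix.submatrix_apply, Matrix.cons_val_zero, Matrix.cons_val_one] at h
  have hji : ρ.mat j i = star (ρ.mat i j) := (ρ.posSemidef.isHermitian.apply j i).symm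
  have hi : ρ.mat i i = (‖ρ.mat i i‖ : ℂ) :=
    (RCLike.norm_of_nonneg' (ρ.posSemidef.diag_nonneg (i := i))).symm
  have hj : ρ.mat j j = (‖ρ.mat j j‖ : ℂ) :=
    (RCLike.norm_of_nonneg' (ρ.posSemidef.diag_nonneg (i := j))).symm
  rw [hji, hi, hj, Complex.star_def, Complex.mul_conj, Complex.normSq_eq_norm_sq] at h
  have h' : ‖ρ.mat i j‖ ^ 2 ≤ ‖ρ.mat i i‖ * ‖ρ.mat j j‖ := by
    have : (0 : ℂ) ≤ ((‖ρ.mat i i‖ * ‖ρ.mat j j‖ - ‖ρ.mat i j‖ ^ 2 : ℝ) : ℂ) := by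
      push_cast
      simpa using h
    rw [Complex.zero_le_real] at this
    linarith
  nlinarith [norm_nonneg (ρ.mat i j), norm_nonneg (ρ.mat i i), norm_nonneg (ρ.mat j j)]

/-- The partial trace over the second system, as a matrix. -/
def partialTrace {α κ : Type} (M : Matrix (α × κ) (α × κ) ℂ) : Matrix α α ℂ :=
  fun a a' => ∑' b, M (a, b) (a', b)

theorem State.summable_partialTrace {α κ : Type} (ρ : State (α × κ)) (a a' : α) :
    Summable (fun b => ρ.mat (a, b) (a', b)) := by
  have hs : Summable (fun x => ‖ρ.mat x x‖) := ρ.hasSum_diag.summable.norm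
  have h1 : ∀ a, Summable (fun b : κ => ‖ρ.mat (a, b) (a, b)‖) := fun a =>
    hs.comp_injective (i := fun b : κ => (a, b)) (fun _ _ h => (Prod.mk.inj h).2)
  exact Summable.of_norm_bounded ((h1 a).add (h1 a')) (fun b => ρ.norm_le _ _)

/-- The reduced density operator `ρ_A` of a state `ρ` of the composite system `AB`. -/
def State.reduceA {α κ : Type} (ρ : State (α × κ)) : State α where
  mat := partialTrace ρ.mat
  posSemidef := by
    constructor
    · ext a a'
      simp only [Matrix.conjTranspose_apply, partialTrace]
      rw [tsum_star]
      exact tsum_congr fun b => ρ.posSemidef.isHermitian.apply (a, b) (a', b)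
    · intro x
      have hsum : HasSum
          (fun b => x.sum fun i xi => x.sum fun j xj => star xi * ρ.mat (i, b) (j, b) * xj)
          (x.sum fun i xi => x.sum fun j xj => star xi * partialTrace ρ.mat i j * xj) := by
        refine hasSum_sum fun i _ => hasSum_sum fun j _ => ?_
        exact ((ρ.summable_partialTrace i j).hasSum.mul_left _).mul_right _
      refine hsum.nonneg fun b => ?_
      exact (ρ.posSemidef.submatrix (fun a => (a, b))).2 x
  hasSum_diag := ρ.hasSum_diag.prod_fiberwise fun a => (ρ.summable_partialTrace a a).hasSum

/-! ### Local operations and correlation monotones -/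

/-- The matrices `K j`, from `ℓ²(ι)` to `ℓ²(ι')`, are the Kraus operators of a quantum operation:
`∑ j, (K j)ᴴ * K j = 1`, in terms of matrix entries. -/
def IsKraus {ι ι' J : Type} (K : J → Matrix ι' ι ℂ) : Prop :=
  ∀ i i' : ι, HasSum (fun x : J × ι' => star (K x.1 x.2 i) * K x.1 x.2 i')
    (open Classical in if i = i' then 1 else 0)

/-- `∑ j, (K j ⊗ 1) M (K j ⊗ 1)ᴴ`: the operation with Kraus operators `K j` on the first system
(finite-dimensional), the second one being unaffected. -/
def applyA {α α' κ J : Type} [Fintype α] [Fintype J] (K : J → Matrix α' α ℂ)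
    (M : Matrix (α × κ) (α × κ) ℂ) : Matrix (α' × κ) (α' × κ) ℂ :=
  fun x y => ∑ j, ∑ a, ∑ a', K j x.1 a * M (a, x.2) (a', y.2) * star (K j y.1 a')

/-- `∑ j, (1 ⊗ K j) M (1 ⊗ K j)ᴴ`: the operation with Kraus operators `K j` on the second system
(of any dimension), the first one being unaffected. For states `M` and Kraus families `K` the inner
and the outer sums converge absolutely. -/
def applyB {α κ κ' J : Type} (K : J → Matrix κ' κ ℂ)
    (M : Matrix (α × κ) (α × κ) ℂ) : Matrix (α × κ') (α × κ') ℂ :=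
  fun x y => ∑' j, ∑' p : κ × κ, K j x.2 p.1 * M (x.1, p.1) (y.1, p.2) * star (K j y.2 p.2)

/-- A correlation monotone `C`, for the finite-dimensional systems `A` and the systems `B` in the
class `P`: a nonnegative function of the states of `AB` that vanishes for product states and is
nonincreasing under the operations on `A` alone and under those on `B` alone (which may change
the Hilbert space of the system they act on). -/
structure IsCorrelationMonotone (P : Type → Prop)
    (C : ∀ α κ : Type, State (α × κ) → ℝ) : Prop where
  nonneg : ∀ (α κ : Type) [Finite α], P κ → ∀ ρ : State (α × κ), 0 ≤ C α κ ρ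
  product : ∀ (α κ : Type) [Finite α], P κ → ∀ (ρ : State (α × κ)) (σ : State α) (τ : State κ),
    ρ.mat = σ.mat ⊗ₖ τ.mat → C α κ ρ = 0
  operationA : ∀ (α α' κ J : Type) [Fintype α] [Fintype α'] [Fintype J], P κ →
    ∀ K : J → Matrix α' α ℂ, IsKraus K →
    ∀ (ρ : State (α × κ)) (ρ' : State (α' × κ)), ρ'.mat = applyA K ρ.mat →
      C α' κ ρ' ≤ C α κ ρ
  operationB : ∀ (α κ κ' J : Type) [Finite α], P κ → P κ' →
    ∀ K : J → Matrix κ' κ ℂ, IsKraus K →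
    ∀ (ρ : State (α × κ)) (ρ' : State (α × κ')), ρ'.mat = applyB K ρ.mat →
      C α κ' ρ' ≤ C α κ ρ

/-! ### Local operations with classical communication and entanglement monotones -/

/-- A finite convex combination of product states. -/
def IsSeparable {m n : ℕ} (ρ : State (Fin m × Fin n)) : Prop :=
  ∃ (k : ℕ) (p : Fin k → ℝ) (σ : Fin k → State (Fin m)) (τ : Fin k → State (Fin n)),
    (∀ i, 0 ≤ p i) ∧ ∑ i, p i = 1 ∧
      ρ.mat = ∑ i, (p i : ℂ) • ((σ i).mat ⊗ₖ (τ i).mat)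

/-- The transformations of bipartite states that consist of finitely many rounds of local
operations and classical communication. In a round one party performs a measurement with Kraus
operators `K i` and announces the outcome `i`, and the remaining protocol may depend on `i`. -/
inductive IsLOCC {m' n' : ℕ} : ∀ {m n : ℕ},
    (Matrix (Fin m × Fin n) (Fin m × Fin n) ℂ → Matrix (Fin m' × Fin n') (Fin m' × Fin n') ℂ) →
      Prop
  | done : IsLOCC (m := m') (n := n') (fun M => M)
  | first {m n l k : ℕ} (K : Fin k → Matrix (Fin l) (Fin m) ℂ) (hK : ∑ i, (K i)ᴴ * K i = 1)
      (Λ : Fin k → Matrix (Fin l × Fin n) (Fin l × Fin n) ℂ →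
        Matrix (Fin m' × Fin n') (Fin m' × Fin n') ℂ)
      (hΛ : ∀ i, IsLOCC (Λ i)) :
      IsLOCC (fun M : Matrix (Fin m × Fin n) (Fin m × Fin n) ℂ =>
        ∑ i, Λ i ((K i ⊗ₖ (1 : Matrix (Fin n) (Fin n) ℂ)) * M *
          (K i ⊗ₖ (1 : Matrix (Fin n) (Fin n) ℂ))ᴴ))
  | second {m n l k : ℕ} (K : Fin k → Matrix (Fin l) (Fin n) ℂ) (hK : ∑ i, (K i)ᴴ * K i = 1)
      (Λ : Fin k → Matrix (Fin m × Fin l) (Fin m × Fin l) ℂ →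
        Matrix (Fin m' × Fin n') (Fin m' × Fin n') ℂ)
      (hΛ : ∀ i, IsLOCC (Λ i)) :
      IsLOCC (fun M : Matrix (Fin m × Fin n) (Fin m × Fin n) ℂ =>
        ∑ i, Λ i (((1 : Matrix (Fin m) (Fin m) ℂ) ⊗ₖ K i) * M *
          ((1 : Matrix (Fin m) (Fin m) ℂ) ⊗ₖ K i)ᴴ))

/-- An entanglement monotone: a nonnegative function of the states of finite-dimensional bipartite
systems that vanishes for separable states and is nonincreasing under local operations and
classical communication. -/
structure IsEntanglementMonotone (E : ∀ m n : ℕ, State (Fin m × Fin n) → ℝ) : Prop where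
  nonneg : ∀ (m n : ℕ) (ρ : State (Fin m × Fin n)), 0 ≤ E m n ρ
  separable : ∀ (m n : ℕ) (ρ : State (Fin m × Fin n)), IsSeparable ρ → E m n ρ = 0
  locc : ∀ (m n m' n' : ℕ)
    (Λ : Matrix (Fin m × Fin n) (Fin m × Fin n) ℂ →
      Matrix (Fin m' × Fin n') (Fin m' × Fin n') ℂ), IsLOCC Λ →
    ∀ (ρ : State (Fin m × Fin n)) (ρ' : State (Fin m' × Fin n')), ρ'.mat = Λ ρ.mat →
      E m' n' ρ' ≤ E m n ρ

/-- `E (t ρ + (1 - t) σ) ≤ t E(ρ) + (1 - t) E(σ)`. -/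
def IsConvexMeasure (E : ∀ m n : ℕ, State (Fin m × Fin n) → ℝ) : Prop :=
  ∀ (m n : ℕ) (ρ σ τ : State (Fin m × Fin n)) (t : ℝ), 0 ≤ t → t ≤ 1 →
    τ.mat = (t : ℂ) • ρ.mat + ((1 - t : ℝ) : ℂ) • σ.mat →
      E m n τ ≤ t * E m n ρ + (1 - t) * E m n σ

/-! ### Probability vectors and the pure-state function -/

/-- Finite probability vectors in decreasing order, padded with zeros to infinite sequences: the
positive components are the components of the vector. The topology is that of componentwise
convergence. -/
abbrev ProbVec : Type :=
  {p : ℕ → ℝ // (∀ i, 0 ≤ p i) ∧ Antitone p ∧ (∃ d, ∀ i, d ≤ i → p i = 0) ∧ HasSum p 1}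

/-- The set `ℰ_d` of the probability vectors with no more than `d` (positive) components. -/
def probVecs (d : ℕ) : Set ProbVec := {p | ∀ i, d ≤ i → p.1 i = 0}

/-- The equally distributed vector `(1/d, …, 1/d)`. -/
def uniform (d : ℕ) (hd : 0 < d) : ProbVec :=
  ⟨fun i => if i < d then 1 / (d : ℝ) else 0, by
    refine ⟨fun i => by positivity, fun i j hij => ?_, ⟨d, fun i hi => if_neg (by omega)⟩, ?_⟩
    · by_cases hj : j < d
      · simp [hj, lt_of_le_of_lt hij hj]
      · simp only [hj, if_false]
        positivity
    · have hne : (d : ℝ) ≠ 0 := by positivity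
      have h := hasSum_sum_of_ne_finset_zero (L := SummationFilter.unconditional ℕ) (s := Finset.range d)
        (f := fun i => if i < d then 1 / (d : ℝ) else 0) (fun i hi =>
          if_neg (fun h => hi (Finset.mem_range.mpr h)))
      have h2 : ∑ i ∈ Finset.range d, (if i < d then 1 / (d : ℝ) else 0) = 1 := by
        rw [Finset.sum_congr rfl (fun i hi => if_pos (Finset.mem_range.mp hi))]
        simp [hne]
      rwa [h2] at h⟩

/-- The number of (positive) components. -/
def ProbVec.size (p : ProbVec) : ℕ := sInf {d | ∀ i, d ≤ i → p.1 i = 0}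

theorem ProbVec.sum_size (p : ProbVec) : ∑ i : Fin (ProbVec.size p), p.1 i = 1 := by
  have hmem : ProbVec.size p ∈ {d | ∀ i, d ≤ i → p.1 i = 0} := Nat.sInf_mem p.2.2.2.1
  have h := hasSum_sum_of_ne_finset_zero (L := SummationFilter.unconditional ℕ) (s := Finset.range (ProbVec.size p)) (f := p.1)
    (fun i hi => hmem i (not_lt.mp fun h => hi (Finset.mem_range.mpr h)))
  rw [Fin.sum_univ_eq_sum_range (fun i => p.1 i)]
  exact h.unique p.2.2.2.2

/-- The vector `∑ i, √(p i) |i⟩|i⟩`, where `i` runs over the components of `p`. -/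
def schmidtVector (p : ProbVec) : Fin (ProbVec.size p) × Fin (ProbVec.size p) → ℂ :=
  fun x => if x.1 = x.2 then (Real.sqrt (p.1 x.1) : ℂ) else 0

/-- The pure state `|ψ⟩⟨ψ|` with `|ψ⟩ = ∑ i, √(p i) |i⟩|i⟩`. -/
def schmidtState (p : ProbVec) : State (Fin (ProbVec.size p) × Fin (ProbVec.size p)) where
  mat := Matrix.vecMulVec (schmidtVector p) (star (schmidtVector p))
  posSemidef := Matrix.posSemidef_vecMulVec_self_star _
  hasSum_diag := by
    have h : ∑ x, Matrix.vecMulVec (schmidtVector p) (star (schmidtVector p)) x x = 1 := by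
      rw [Fintype.sum_prod_type]
      have : ∀ i j : Fin (ProbVec.size p),
          Matrix.vecMulVec (schmidtVector p) (star (schmidtVector p)) (i, j) (i, j)
            = if i = j then (p.1 i : ℂ) else 0 := by
        intro i j
        by_cases hij : i = j
        · simp only [Matrix.vecMulVec_apply, schmidtVector, Pi.star_apply, hij, if_true,
            Complex.star_def, Complex.conj_ofReal]
          rw [← Complex.ofReal_mul, Real.mul_self_sqrt (p.2.1 _)]
        · simp [Matrix.vecMulVec_apply, schmidtVector, hij]
      simp only [this, Finset.sum_ite_eq, Finset.mem_univ, if_true]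
      rw [← Complex.ofReal_sum, ProbVec.sum_size, Complex.ofReal_one]
    rw [← h]
    exact hasSum_fintype _

/-- The function `f` of a correlation monotone `C`: `f p` is the value of `C` for the pure states
with Schmidt coefficients `√(p i)`. These are all related to each other by local isometries, and
the one in the smallest possible Hilbert space is used here. -/
def pureStateFunction (C : ∀ α κ : Type, State (α × κ) → ℝ) (p : ProbVec) : ℝ :=
  C (Fin (ProbVec.size p)) (Fin (ProbVec.size p)) (schmidtState p)

/-- The supremum `c_d` of `f` on `ℰ_d`. -/
def maxCorrelation (C : ∀ α κ : Type, State (α × κ) → ℝ) (d : ℕ) : ℝ :=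
  sSup (pureStateFunction C '' probVecs d)

end QCorr

end

noncomputable section

namespace QCorr

/-! Both sides of the tradeoff are governed by the marginal `σ = ρ_A`. Among the extensions of `σ`,
a purification has the largest correlation, because every other extension arises from it by an
operation on `B` alone (`exists_kraus_of_purification`, for `B` of any dimension). This maximum is
`f` of the sorted spectrum of `σ` (`IsCorrelationMonotone.le_pureStateFunction`,
`IsCorrelationMonotone.pure_eq`). So `ξ x` is the supremum of `E σ` over the `σ` whose spectrum
satisfies `f ≥ x`. This makes `ξ` antitone and gives the bound.

For tightness the correlation must be exactly `x`. Fix an eigenbasis of a nearly optimal `σ`. Since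
`E` is convex in the eigenvalues, `E` stays at least `E σ` along the segment from `σ` to at least
one of its eigenprojections (`exists_vertex_le`). At that pure end `f` vanishes, so continuity of
`f` and of sorting (`continuous_sortVec`) provides a point with `f = x`, and its purification is the
required state.

The constant `e` is the value of `E` at the maximally entangled state, from which every state is
prepared by one measurement and a unitary correction, as in teleportation
(`IsEntanglementMonotone.le_maxEnt`). If only the uniform spectrum attains the maximum of `f`, the
marginal there is maximally mixed, hence separable. -/

/-! ### Gram decomposition of positive semidefinite matrices of arbitrary size -/

/-- The semi-inner product on `X →₀ ℂ` given by a positive semidefinite matrix. -/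
@[reducible]
def gramCore {X : Type} {M : Matrix X X ℂ} (hM : M.PosSemidef) :
    PreInnerProductSpace.Core ℂ (X →₀ ℂ) where
  inner f g := f.sum fun i xi => g.sum fun j xj => star xi * M i j * xj
  conj_inner_symm f g := by
    rw [Finsupp.sum_comm]
    simp only [map_finsuppSum]
    refine Finset.sum_congr rfl fun i _ => Finset.sum_congr rfl fun j _ => ?_
    have h : star (M j i) = M i j := hM.isHermitian.apply i j
    change (starRingEnd ℂ) (star (g j) * M j i * f i) = star (f i) * M i j * g j
    rw [← h]
    simp only [Complex.star_def, map_mul, Complex.conj_conj]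
    ring
  add_left f g h := by
    rw [Finsupp.sum_add_index'] <;> simp [← Finsupp.sum_add, add_mul]
  smul_left f g c := by
    rw [Finsupp.sum_smul_index] <;> simp [Finsupp.mul_sum, mul_assoc]
  re_inner_nonneg f := (Complex.le_def.mp (hM.2 f)).1

/-- In the completed semi-inner product space the basis vectors have Gram matrix `M`, and Parseval's
identity in a Hilbert basis expands each entry. For a state this replaces the spectral
decomposition, with no restriction on the dimension of `B`. -/
theorem exists_gram_decomposition {X : Type} {M : Matrix X X ℂ} (hM : M.PosSemidef) :
    ∃ (J : Type) (w : J → X → ℂ), ∀ x y, HasSum (fun j => w j x * star (w j y)) (M x y) := by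
  let : SeminormedAddCommGroup (X →₀ ℂ) :=
    InnerProductSpace.Core.toSeminormedAddCommGroup (𝕜 := ℂ) (c := gramCore hM)
  let : InnerProductSpace ℂ (X →₀ ℂ) := .ofCore (gramCore hM)
  obtain ⟨J, b, -⟩ := exists_hilbertBasis ℂ (UniformSpace.Completion (X →₀ ℂ))
  let e : X → UniformSpace.Completion (X →₀ ℂ) := fun x =>
    ((Finsupp.single x 1 : X →₀ ℂ) : UniformSpace.Completion (X →₀ ℂ))
  refine ⟨J, fun j x => inner ℂ (e x) (b j), fun x y => ?_⟩
  have h := b.hasSum_inner_mul_inner (e x) (e y)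
  have hxy : inner ℂ (e x) (e y) = M x y := by
    simp only [e, UniformSpace.Completion.inner_coe]
    change (Finsupp.single x (1 : ℂ)).sum (fun i xi =>
      (Finsupp.single y (1 : ℂ)).sum fun j xj => star xi * M i j * xj) = M x y
    simp
  rw [hxy] at h
  simpa using h

/-! ### Purifications -/

/-- The rank one matrix `|ψ⟩⟨ψ|` where `ψ` has the components `G a i`. -/
def pureMat {α R : Type} (G : Matrix α R ℂ) : Matrix (α × R) (α × R) ℂ :=
  Matrix.vecMulVec (fun x => G x.1 x.2) (star fun x => G x.1 x.2)

theorem pureMat_apply {α R : Type} (G : Matrix α R ℂ) (x y : α × R) :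
    pureMat G x y = G x.1 x.2 * star (G y.1 y.2) := rfl

theorem norm_mul_star_le (z w : ℂ) : ‖z * star w‖ ≤ ‖z * star z‖ + ‖w * star w‖ := by
  simp only [norm_mul, norm_star]
  nlinarith [sq_nonneg (‖z‖ - ‖w‖), sq_nonneg (‖z‖), sq_nonneg ‖w‖]

/-- The diagonal terms are nonnegative and sum to a finite partial trace; the others are dominated
by them. Absolute summability is what permits exchanging the sums over `J` and `κ`. -/
theorem summable_norm_gram {α κ J : Type} (ρ : State (α × κ)) {w : J → α × κ → ℂ}
    (hw : ∀ x y, HasSum (fun j => w j x * star (w j y)) (ρ.mat x y)) (a a' : α) :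
    Summable fun x : κ × J => ‖w x.2 (a, x.1) * star (w x.2 (a', x.1))‖ := by
  have key : ∀ a, Summable fun x : κ × J => ‖w x.2 (a, x.1) * star (w x.2 (a, x.1))‖ := by
    intro a
    have hn : ∀ b, HasSum (fun j => ‖w j (a, b) * star (w j (a, b))‖) ‖ρ.mat (a, b) (a, b)‖ := by
      intro b
      have h := Complex.hasSum_re (hw (a, b) (a, b))
      have e1 : ∀ z : ℂ, 0 ≤ z → z.re = ‖z‖ := fun z hz => by
        have := RCLike.norm_of_nonneg' hz
        exact (congrArg Complex.re this).symm.trans (Complex.ofReal_re _)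
      rw [e1 _ ρ.posSemidef.diag_nonneg] at h
      refine h.congr_fun fun j => ?_
      exact (e1 _ (mul_star_self_nonneg _)).symm
    refine (summable_prod_of_nonneg fun _ => norm_nonneg _).mpr ⟨fun b => (hn b).summable, ?_⟩
    simp only [(hn _).tsum_eq]
    exact (ρ.summable_partialTrace a a).norm
  exact Summable.of_nonneg_of_le (fun _ => norm_nonneg _) (fun x => norm_mul_star_le _ _)
    ((key a).add (key a'))

theorem hasSum_gram_reduceA {α κ J : Type} (ρ : State (α × κ)) {w : J → α × κ → ℂ}
    (hw : ∀ x y, HasSum (fun j => w j x * star (w j y)) (ρ.mat x y)) (a a' : α) :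
    HasSum (fun x : J × κ => w x.1 (a, x.2) * star (w x.1 (a', x.2))) (ρ.reduceA.mat a a') := by
  have hs : Summable fun x : κ × J => w x.2 (a, x.1) * star (w x.2 (a', x.1)) :=
    (summable_norm_gram ρ hw a a').of_norm
  have h := hs.hasSum
  have h2 := (h.prod_fiberwise fun b => hw (a, b) (a', b)).unique
    (ρ.summable_partialTrace a a').hasSum
  rw [h2] at h
  exact (Equiv.prodComm J κ).hasSum_iff.mpr h

/-- The vectors `w j (·, b)` form an ensemble for the marginal, so their images under `F` form one
for `F ρ_A Fᴴ`. With `F` a left inverse of `G` this is completeness of the Kraus operators; with `1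
- G * F` it confines the ensemble to the range of `G`. -/
theorem hasSum_gram_mul {α κ J R : Type} [Fintype α] (ρ : State (α × κ)) {w : J → α × κ → ℂ}
    (hw : ∀ x y, HasSum (fun j => w j x * star (w j y)) (ρ.mat x y)) (F : Matrix R α ℂ) (r s : R) :
    HasSum (fun x : J × κ => (∑ a, F r a * w x.1 (a, x.2)) * star (∑ a, F s a * w x.1 (a, x.2)))
      ((F * ρ.reduceA.mat * Fᴴ) r s) := by
  have h : HasSum (fun x : J × κ => ∑ a', ∑ a, F r a * (w x.1 (a, x.2) * star (w x.1 (a', x.2))) *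
      star (F s a')) (∑ a', ∑ a, F r a * ρ.reduceA.mat a a' * star (F s a')) :=
    hasSum_sum fun a' _ => hasSum_sum fun a _ =>
      ((hasSum_gram_reduceA ρ hw a a').mul_left _).mul_right _
  have e : (F * ρ.reduceA.mat * Fᴴ) r s =
      ∑ a', ∑ a, F r a * ρ.reduceA.mat a a' * star (F s a') := by
    simp only [Matrix.mul_apply, Matrix.conjTranspose_apply, Finset.sum_mul]
  rw [e]
  refine h.congr_fun fun x => ?_
  rw [star_sum, Finset.sum_mul_sum, Finset.sum_comm]
  simp only [star_mul']
  refine Finset.sum_congr rfl fun a' _ => Finset.sum_congr rfl fun a _ => by ring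

/-- Every state of `AB` is obtained, by an operation on the second system alone, from a
purification of its reduced state. -/
theorem exists_kraus_of_purification {α κ R : Type} [Fintype α] [DecidableEq α] [Fintype R]
    [DecidableEq R] (ρ : State (α × κ)) (G : Matrix α R ℂ) (F : Matrix R α ℂ) (hFG : F * G = 1)
    (hρ : ρ.reduceA.mat = G * Gᴴ) :
    ∃ (J : Type) (K : J → Matrix κ R ℂ), IsKraus K ∧ ρ.mat = applyB K (pureMat G) := by
  obtain ⟨J, w, hw⟩ := exists_gram_decomposition ρ.posSemidef
  -- The Kraus operators are forced by `G (K j)ᵀ = w j`, where `w j` is read as a matrix: apply the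
  -- left inverse `F`.
  refine ⟨J, fun j b i => ∑ a, F i a * w j (a, b), fun i i' => ?_, ?_⟩
  · have h := hasSum_gram_mul ρ hw F i' i
    have h1 : F * ρ.reduceA.mat * Fᴴ = 1 := by
      rw [hρ, ← Matrix.mul_assoc, hFG, Matrix.one_mul, ← Matrix.conjTranspose_mul, hFG,
        Matrix.conjTranspose_one]
    rw [h1, Matrix.one_apply] at h
    convert h using 1
    · ext x
      exact mul_comm _ _
    · simp [eq_comm]
  -- `1 - G * F` annihilates the marginal, so the squared norms of the components outside the range
  -- of `G` sum to zero, and each of them vanishes.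
  · have hrange : ∀ j b a, ∑ i, G a i * ∑ a', F i a' * w j (a', b) = w j (a, b) := by
      intro j b a
      have h := hasSum_gram_mul ρ hw (1 - G * F) a a
      have h0 : (1 - G * F) * ρ.reduceA.mat = 0 := by
        rw [hρ, ← Matrix.mul_assoc, Matrix.sub_mul, Matrix.mul_assoc G, hFG]
        simp
      rw [h0, Matrix.zero_mul, Matrix.zero_apply] at h
      have h' : HasSum (fun x : J × κ => ‖∑ a', (1 - G * F : Matrix α α ℂ) a a' *
          w x.1 (a', x.2)‖ ^ 2) 0 := by
        refine (Complex.hasSum_re h).congr_fun fun x => ?_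
        rw [Complex.star_def, Complex.mul_conj, Complex.normSq_eq_norm_sq, Complex.ofReal_re]
      have hz := (hasSum_zero_iff_of_nonneg fun x => by positivity).mp h'
      have hz' := congrFun hz (j, b)
      simp only [Pi.zero_apply, pow_eq_zero_iff (two_ne_zero), norm_eq_zero, Matrix.sub_apply,
        sub_mul, Finset.sum_sub_distrib, Matrix.one_apply, ite_mul, one_mul, zero_mul,
        Finset.sum_ite_eq, Finset.mem_univ, if_true, sub_eq_zero] at hz'
      rw [hz']
      simp only [Matrix.mul_apply, Finset.mul_sum, Finset.sum_mul]
      rw [Finset.sum_comm]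
      refine Finset.sum_congr rfl fun a' _ => Finset.sum_congr rfl fun i _ => by ring
    ext x y
    rw [← (hw x y).tsum_eq]
    refine tsum_congr fun j => ?_
    rw [tsum_fintype, Fintype.sum_prod_type]
    conv_lhs => rw [show x = (x.1, x.2) from rfl, show y = (y.1, y.2) from rfl,
      ← hrange j x.2 x.1, ← hrange j y.2 y.1, star_sum, Finset.sum_mul_sum]
    refine Finset.sum_congr rfl fun i _ => Finset.sum_congr rfl fun i' _ => ?_
    simp only [pureMat_apply, star_mul']
    ring

/-! ### Pure states -/

theorem posSemidef_pureMat {α R : Type} [Finite α] [Finite R] (G : Matrix α R ℂ) : (pureMat G).PosSemidef :=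
  Matrix.posSemidef_vecMulVec_self_star _

theorem trace_pureMat {α R : Type} [Fintype α] [Fintype R] (G : Matrix α R ℂ) :
    (pureMat G).trace = (G * Gᴴ).trace := by
  simp [Matrix.trace, Fintype.sum_prod_type, pureMat_apply, Matrix.mul_apply]

/-- A density matrix as a state. -/
def State.ofTrace {ι : Type} [Fintype ι] (M : Matrix ι ι ℂ) (hM : M.PosSemidef)
    (ht : M.trace = 1) : State ι where
  mat := M
  posSemidef := hM
  hasSum_diag := by
    rw [← ht]
    exact hasSum_fintype _

theorem State.trace_eq {ι : Type} [Fintype ι] (ρ : State ι) : ρ.mat.trace = 1 :=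
  (hasSum_fintype _).unique ρ.hasSum_diag

/-- The pure state whose state vector has the components `G a i`. -/
def pureState {α R : Type} [Fintype α] [Fintype R] (G : Matrix α R ℂ)
    (hG : (G * Gᴴ).trace = 1) : State (α × R) :=
  State.ofTrace (pureMat G) (posSemidef_pureMat G) (by rw [trace_pureMat, hG])

theorem reduceA_pureState {α R : Type} [Fintype α] [Fintype R] (G : Matrix α R ℂ)
    (hG : (G * Gᴴ).trace = 1) : (pureState G hG).reduceA.mat = G * Gᴴ := by
  ext a a'
  change ∑' b, pureMat G (a, b) (a', b) = _
  simp [tsum_fintype, pureMat_apply, Matrix.mul_apply]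

theorem isKraus_of_sum_eq_one {ι ι' J : Type} [Fintype ι] [DecidableEq ι] [Fintype ι'] [Fintype J]
    {K : J → Matrix ι' ι ℂ} (hK : ∑ j, (K j)ᴴ * K j = 1) : IsKraus K := by
  intro i i'
  have h := congrFun (congrFun hK i) i'
  rw [Matrix.one_apply] at h
  convert hasSum_fintype (fun x : J × ι' => star (K x.1 x.2 i) * K x.1 x.2 i') using 1
  rw [Fintype.sum_prod_type]
  simp only [Matrix.sum_apply, Matrix.mul_apply, Matrix.conjTranspose_apply] at h
  rw [h]
  congr

theorem applyA_pureMat {α α' R J : Type} [Fintype α] [Fintype J] (K : J → Matrix α' α ℂ)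
    (G : Matrix α R ℂ) : applyA K (pureMat G) = ∑ j, pureMat (K j * G) := by
  ext x y
  simp only [applyA, Matrix.sum_apply, pureMat_apply, Matrix.mul_apply, star_sum,
    Finset.sum_mul_sum, star_mul']
  refine Finset.sum_congr rfl fun j _ => Finset.sum_congr rfl fun a _ =>
    Finset.sum_congr rfl fun a' _ => by ring

theorem schmidtState_mat (p : ProbVec) : (schmidtState p).mat =
    pureMat (Matrix.diagonal fun i : Fin (ProbVec.size p) => (Real.sqrt (p.1 i) : ℂ)) := by
  ext x y
  simp only [schmidtState, pureMat, Matrix.vecMulVec_apply, Pi.star_apply, schmidtVector,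
    Matrix.diagonal_apply]

theorem ProbVec.eq_zero_of_size_le (p : ProbVec) {i : ℕ} (hi : ProbVec.size p ≤ i) : p.1 i = 0 :=
  (Nat.sInf_mem p.2.2.2.1 : ProbVec.size p ∈ {d | ∀ i, d ≤ i → p.1 i = 0}) i hi

theorem ProbVec.pos_of_lt_size (p : ProbVec) {i : ℕ} (hi : i < ProbVec.size p) : 0 < p.1 i := by
  refine lt_of_le_of_ne (p.2.1 i) fun h => ?_
  have := Nat.notMem_of_lt_sInf hi
  exact this fun j hj => le_antisymm ((p.2.2.1 hj).trans h.ge) (p.2.1 j)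

theorem ProbVec.size_pos (p : ProbVec) : 0 < ProbVec.size p := by
  by_contra h
  have := ProbVec.sum_size p
  rw [Finset.sum_eq_zero fun i _ => absurd i.pos h] at this
  exact zero_ne_one this

/-- The Kraus operators `Vᴴ` and `|0⟩⟨a|(1 - V Vᴴ)`, which undo the isometry `V`. -/
def undoKraus {α R : Type} [Fintype α] [DecidableEq α] [Fintype R] [DecidableEq R]
    (V : Matrix α R ℂ) (r : R) : Option α → Matrix R α ℂ
  | none => Vᴴ
  | some a => (Matrix.single r a 1 : Matrix R α ℂ) * (1 - V * Vᴴ)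

theorem undoKraus_none_mul {α R : Type} [Fintype α] [DecidableEq α] [Fintype R] [DecidableEq R]
    {V : Matrix α R ℂ} (hV : Vᴴ * V = 1) (r : R) : undoKraus V r none * V = 1 := hV

theorem undoKraus_some_mul {α R : Type} [Fintype α] [DecidableEq α] [Fintype R] [DecidableEq R]
    {V : Matrix α R ℂ} (hV : Vᴴ * V = 1) (r : R) (a : α) : undoKraus V r (some a) * V = 0 := by
  simp only [undoKraus]
  rw [Matrix.mul_assoc, Matrix.sub_mul, Matrix.mul_assoc V, hV]
  simp

/-- `Vᴴ` alone contributes the projection `V Vᴴ`; the branches `some a` supply the complementary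
projection, since the operators `|a⟩⟨r|r⟩⟨a|` sum to the identity. -/
theorem sum_undoKraus {α R : Type} [Fintype α] [DecidableEq α] [Fintype R] [DecidableEq R]
    {V : Matrix α R ℂ} (hV : Vᴴ * V = 1) (r : R) :
    ∑ j, (undoKraus V r j)ᴴ * undoKraus V r j = 1 := by
  have hQ : (1 - V * Vᴴ)ᴴ = 1 - V * Vᴴ := by simp
  have hQQ : (1 - V * Vᴴ) * (1 - V * Vᴴ) = 1 - V * Vᴴ := by
    have : V * Vᴴ * (V * Vᴴ) = V * Vᴴ := by
      rw [Matrix.mul_assoc, ← Matrix.mul_assoc Vᴴ, hV, Matrix.one_mul]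
    rw [Matrix.sub_mul, Matrix.mul_sub, Matrix.mul_sub, this]
    simp
  have h1 : ∑ a : α, (Matrix.single r a 1 : Matrix R α ℂ)ᴴ * (Matrix.single r a 1 : Matrix R α ℂ) = 1 := by
    simp only [Matrix.conjTranspose_single, star_one, Matrix.single_mul_single_same, mul_one]
    exact Matrix.sum_single_one
  rw [Fintype.sum_option]
  simp only [undoKraus, Matrix.conjTranspose_mul, Matrix.conjTranspose_conjTranspose, hQ]
  have h2 : ∀ a : α, (1 - V * Vᴴ) * (Matrix.single r a 1 : Matrix R α ℂ)ᴴ *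
      ((Matrix.single r a 1 : Matrix R α ℂ) * (1 - V * Vᴴ)) =
      (1 - V * Vᴴ) * ((Matrix.single r a 1 : Matrix R α ℂ)ᴴ * (Matrix.single r a 1 : Matrix R α ℂ)) * (1 - V * Vᴴ) := by
    intro a
    simp only [Matrix.mul_assoc]
  simp only [h2]
  rw [← Finset.sum_mul, ← Finset.mul_sum, h1, Matrix.mul_one, hQQ]
  simp

section
variable {P : Type → Prop} {C : ∀ α κ : Type, State (α × κ) → ℝ}

/-- Pure states have the value of the pure-state function at their Schmidt coefficients. -/
theorem IsCorrelationMonotone.pure_eq (hC : IsCorrelationMonotone P C)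
    (hP : ∀ κ : Type, Finite κ → P κ) {α : Type} [Fintype α] [DecidableEq α] (p : ProbVec)
    (V : Matrix α (Fin (ProbVec.size p)) ℂ) (hV : Vᴴ * V = 1)
    (ρ : State (α × Fin (ProbVec.size p)))
    (hρ : ρ.mat = pureMat (V * Matrix.diagonal fun i : Fin (ProbVec.size p) => (Real.sqrt (p.1 i) : ℂ))) :
    C α (Fin (ProbVec.size p)) ρ = pureStateFunction C p := by
  have hPf : P (Fin (ProbVec.size p)) := hP _ inferInstance
  apply le_antisymm
  · refine hC.operationA _ _ _ Unit hPf (fun _ => V) (isKraus_of_sum_eq_one (by simpa using hV))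
      (schmidtState p) ρ ?_
    rw [hρ, schmidtState_mat, applyA_pureMat]
    simp
  · refine hC.operationA _ _ _ (Option α) hPf (undoKraus V ⟨0, ProbVec.size_pos p⟩)
      (isKraus_of_sum_eq_one (sum_undoKraus hV _)) ρ (schmidtState p) ?_
    rw [hρ, schmidtState_mat, applyA_pureMat, Fintype.sum_option]
    simp only [← Matrix.mul_assoc, undoKraus_none_mul hV, undoKraus_some_mul hV, Matrix.one_mul,
      Matrix.zero_mul]
    rw [Finset.sum_eq_zero, add_zero]
    intro a _
    ext x y
    simp [pureMat_apply]

theorem isometry_diag_mul_conjTranspose {α : Type} [Fintype α] (p : ProbVec)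
    (V : Matrix α (Fin (ProbVec.size p)) ℂ) :
    (V * Matrix.diagonal fun i : Fin (ProbVec.size p) => (Real.sqrt (p.1 i) : ℂ)) *
      (V * Matrix.diagonal fun i : Fin (ProbVec.size p) => (Real.sqrt (p.1 i) : ℂ))ᴴ =
    V * (Matrix.diagonal fun i : Fin (ProbVec.size p) => (p.1 i : ℂ)) * Vᴴ := by
  rw [Matrix.conjTranspose_mul, Matrix.diagonal_conjTranspose, Matrix.mul_assoc,
    ← Matrix.mul_assoc (Matrix.diagonal _), Matrix.diagonal_mul_diagonal, ← Matrix.mul_assoc]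
  congr 3
  ext i
  simp only [Pi.star_apply, Complex.star_def, Complex.conj_ofReal]
  rw [← Complex.ofReal_mul, Real.mul_self_sqrt (p.2.1 _)]

/-- The pure state maximizes a correlation monotone over the states with a given marginal. -/
theorem IsCorrelationMonotone.le_pureStateFunction (hC : IsCorrelationMonotone P C)
    (hP : ∀ κ : Type, Finite κ → P κ) {α κ : Type} [Fintype α] [DecidableEq α] (hκ : P κ)
    (p : ProbVec) (V : Matrix α (Fin (ProbVec.size p)) ℂ) (hV : Vᴴ * V = 1) (ρ : State (α × κ))
    (hρ : ρ.reduceA.mat = V * (Matrix.diagonal fun i : Fin (ProbVec.size p) => (p.1 i : ℂ)) * Vᴴ) :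
    C α κ ρ ≤ pureStateFunction C p := by
  set G := V * Matrix.diagonal fun i : Fin (ProbVec.size p) => (Real.sqrt (p.1 i) : ℂ) with hG
  have hGG : ρ.reduceA.mat = G * Gᴴ := by rw [hρ, hG, isometry_diag_mul_conjTranspose]
  -- The square roots are invertible because only the positive components of `p` are indexed.
  have hF : ((Matrix.diagonal fun i : Fin (ProbVec.size p) => ((Real.sqrt (p.1 i) : ℂ))⁻¹) * Vᴴ) *
      G = 1 := by
    rw [hG, Matrix.mul_assoc, ← Matrix.mul_assoc Vᴴ, hV, Matrix.one_mul,
      Matrix.diagonal_mul_diagonal, ← Matrix.diagonal_one]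
    congr 1
    ext i
    refine inv_mul_cancel₀ ?_
    exact Complex.ofReal_ne_zero.mpr (Real.sqrt_pos.mpr (p.pos_of_lt_size i.2)).ne'
  obtain ⟨J, K, hK, h⟩ := exists_kraus_of_purification ρ G _ hF hGG
  have htr : (G * Gᴴ).trace = 1 := by rw [← hGG, State.trace_eq]
  have h1 := hC.operationB α _ κ J (hP _ inferInstance) hκ K hK (pureState G htr) ρ h
  rwa [hC.pure_eq hP p V hV (pureState G htr) rfl] at h1

/-- The pure-state function vanishes at the vector with a single component. -/
theorem IsCorrelationMonotone.pureStateFunction_eq_zero (hC : IsCorrelationMonotone P C)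
    (hP : ∀ κ : Type, Finite κ → P κ) (p : ProbVec) (hp : ∀ i, 1 ≤ i → p.1 i = 0) :
    pureStateFunction C p = 0 := by
  have h1 : ProbVec.size p = 1 :=
    le_antisymm (Nat.sInf_le (show 1 ∈ {d | ∀ i, d ≤ i → p.1 i = 0} from hp)) p.size_pos
  have hs : Subsingleton (Fin (ProbVec.size p)) := by rw [h1]; infer_instance
  let σ : State (Fin (ProbVec.size p)) := State.ofTrace 1 Matrix.PosSemidef.one (by simp [h1])
  refine hC.product _ _ (hP _ inferInstance) (schmidtState p) σ σ ?_
  have hx : ∀ x y : Fin (ProbVec.size p) × Fin (ProbVec.size p),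
      (schmidtState p).mat x y = 1 := by
    intro x y
    have h := (schmidtState p).trace_eq
    rw [Matrix.trace, Fintype.sum_subsingleton _ x] at h
    rw [Subsingleton.elim y x]
    exact h
  ext x y
  rw [hx, Matrix.kroneckerMap_apply, Subsingleton.elim y x]
  change 1 = (1 : Matrix _ _ ℂ) x.1 x.1 * (1 : Matrix _ _ ℂ) x.2 x.2
  simp

end

/-! ### Sorting probability vectors -/

/-- A permutation that puts the components of `q` in decreasing order. -/
def sortPerm {d : ℕ} (q : Fin d → ℝ) : Equiv.Perm (Fin d) := Tuple.sort fun i => -q i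

theorem antitone_comp_sortPerm {d : ℕ} (q : Fin d → ℝ) : Antitone (q ∘ sortPerm q) := by
  intro i j hij
  exact neg_le_neg_iff.mp (Tuple.monotone_sort (fun i => -q i) hij)

/-- With ties the sorting permutation is not unique, but the sorted vector is. Hence any convenient
permutation may replace `sortPerm q`. -/
theorem comp_sortPerm_eq {d : ℕ} {q : Fin d → ℝ} {π : Equiv.Perm (Fin d)} (h : Antitone (q ∘ π)) :
    q ∘ sortPerm q = q ∘ π := by
  have h1 : Monotone ((fun i => -q i) ∘ π) := fun i j hij => neg_le_neg (h hij)
  have h2 := Tuple.comp_sort_eq_comp_iff_monotone.mpr h1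
  ext i
  have := congrFun h2 i
  simp only [Function.comp_apply, neg_inj] at this
  exact this.symm

/-- The probability vector with the components of `q` in decreasing order. -/
def sortVec {d : ℕ} (q : stdSimplex ℝ (Fin d)) : ProbVec :=
  ⟨fun i => if h : i < d then q (sortPerm q ⟨i, h⟩) else 0, by
    refine ⟨fun i => ?_, fun i j hij => ?_, ⟨d, fun i hi => dif_neg hi.not_gt⟩, ?_⟩
    · dsimp only
      split_ifs
      · exact q.2.1 _
      · exact le_rfl
    · by_cases hj : j < d
      · simp only [hj, lt_of_le_of_lt hij hj, dif_pos]
        exact antitone_comp_sortPerm q (show (⟨i, _⟩ : Fin d) ≤ ⟨j, hj⟩ from hij)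
      · simp only [hj, dif_neg, not_false_eq_true]
        split_ifs
        · exact q.2.1 _
        · exact le_rfl
    · have h := hasSum_sum_of_ne_finset_zero (L := SummationFilter.unconditional ℕ)
        (s := Finset.range d)
        (f := fun i => if h : i < d then q (sortPerm q ⟨i, h⟩) else 0) (fun i hi =>
          dif_neg (fun h => hi (Finset.mem_range.mpr h)))
      rw [← Fin.sum_univ_eq_sum_range
        (fun i => if h : i < d then q (sortPerm q ⟨i, h⟩) else 0)] at h
      simp only [Fin.is_lt, dif_pos, Fin.eta] at h
      rw [Equiv.sum_comp (sortPerm q) (fun i => q i)] at h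
      exact q.2.2 ▸ h⟩

theorem sortVec_apply {d : ℕ} (q : stdSimplex ℝ (Fin d)) (i : ℕ) :
    (sortVec q).1 i = if h : i < d then q (sortPerm q ⟨i, h⟩) else 0 := rfl

theorem sortVec_apply_of_antitone {d : ℕ} {q : stdSimplex ℝ (Fin d)} {π : Equiv.Perm (Fin d)}
    (h : Antitone (q ∘ π)) (i : ℕ) :
    (sortVec q).1 i = if h : i < d then q (π ⟨i, h⟩) else 0 := by
  rw [sortVec_apply]
  split_ifs with hi
  · exact congrFun (comp_sortPerm_eq h) ⟨i, hi⟩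
  · rfl

theorem sortVec_mem_probVecs {d : ℕ} (q : stdSimplex ℝ (Fin d)) : sortVec q ∈ probVecs d :=
  fun _ hi => dif_neg hi.not_gt

/-- The simplex is a finite union of closed sets, on each of which one fixed permutation sorts.
There the map only permutes coordinates, and continuity is glued over the closed cover. -/
theorem continuous_sortVec (d : ℕ) : Continuous (sortVec : stdSimplex ℝ (Fin d) → ProbVec) := by
  have hev : ∀ i : Fin d, Continuous fun q : stdSimplex ℝ (Fin d) => q i := fun i =>
    (continuous_apply i).comp continuous_subtype_val
  refine (locallyFinite_of_finite fun π : Equiv.Perm (Fin d) =>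
    {q : stdSimplex ℝ (Fin d) | Antitone (q ∘ π)}).continuous ?_ (fun π => ?_) fun π => ?_
  · refine Set.eq_univ_of_forall fun q => Set.mem_iUnion.mpr ⟨sortPerm q, ?_⟩
    exact antitone_comp_sortPerm q
  · simp only [Antitone, Function.comp_apply, Set.ofPred_forall]
    exact isClosed_iInter fun i => isClosed_iInter fun j => isClosed_iInter fun _ =>
      isClosed_le (hev _) (hev _)
  · rw [continuousOn_iff_continuous_domRestrict]
    refine Continuous.subtype_mk (continuous_pi fun i => ?_) _
    have : (fun q : {q : stdSimplex ℝ (Fin d) | Antitone (q ∘ π)} => (sortVec q.1).1 i) =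
        fun q => if h : i < d then q.1 (π ⟨i, h⟩) else 0 :=
      funext fun q => sortVec_apply_of_antitone q.2 i
    change Continuous fun q : {q : stdSimplex ℝ (Fin d) | Antitone (q ∘ π)} => (sortVec q.1).1 i
    rw [this]
    split_ifs
    · exact (hev _).comp continuous_subtype_val
    · exact continuous_const

theorem ProbVec.sum_eq_one_of_mem (d : ℕ) {p : ProbVec} (hp : p ∈ probVecs d) :
    ∑ i : Fin d, p.1 i = 1 := by
  have h := hasSum_sum_of_ne_finset_zero (L := SummationFilter.unconditional ℕ)
    (s := Finset.range d) (f := p.1)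
    (fun i hi => hp i (not_lt.mp fun h => hi (Finset.mem_range.mpr h)))
  rw [Fin.sum_univ_eq_sum_range (fun i => p.1 i)]
  exact h.unique p.2.2.2.2

theorem range_sortVec (d : ℕ) : Set.range (sortVec : stdSimplex ℝ (Fin d) → ProbVec) =
    probVecs d := by
  apply subset_antisymm
  · rintro _ ⟨q, rfl⟩
    exact sortVec_mem_probVecs q
  · intro p hp
    refine ⟨⟨fun i => p.1 i, fun i => p.2.1 i, ProbVec.sum_eq_one_of_mem d hp⟩, ?_⟩
    apply Subtype.ext
    ext i
    have h1 : Antitone ((fun i : Fin d => p.1 i) ∘ (1 : Equiv.Perm (Fin d))) :=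
      fun i j hij => p.2.2.1 hij
    rw [sortVec_apply_of_antitone (π := 1) h1]
    split_ifs with hi
    · rfl
    · exact (hp i (not_lt.mp hi)).symm

theorem isCompact_probVecs (d : ℕ) : IsCompact (probVecs d) := by
  rw [← range_sortVec]
  exact isCompact_range (continuous_sortVec d)

theorem sortVec_single {d : ℕ} (k : Fin d) {q : stdSimplex ℝ (Fin d)}
    (hq : ∀ i, i ≠ k → q i = 0) (i : ℕ) (hi : 1 ≤ i) : (sortVec q).1 i = 0 := by
  have hd : 0 < d := k.pos
  have h : Antitone (q ∘ Equiv.swap ⟨0, hd⟩ k) := by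
    intro i j hij
    by_cases hj : j = ⟨0, hd⟩
    · have : i = ⟨0, hd⟩ := by
        apply Fin.ext
        have : i.1 ≤ j.1 := hij
        rw [hj] at this
        simpa using this
      rw [this, hj]
    · have : q (Equiv.swap ⟨0, hd⟩ k j) = 0 := by
        refine hq _ fun h => hj ?_
        rwa [Equiv.swap_apply_eq_iff, Equiv.swap_apply_right] at h
      simp only [Function.comp_apply, this]
      exact q.2.1 _
  rw [sortVec_apply_of_antitone h]
  split_ifs with hi'
  · refine hq _ fun h => ?_
    rw [Equiv.swap_apply_eq_iff, Equiv.swap_apply_right] at h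
    have := congrArg Fin.val h
    simp only at this
    omega
  · rfl

theorem sortVec_eq_uniform {d : ℕ} (hd : 0 < d) {q : stdSimplex ℝ (Fin d)}
    (h : sortVec q = uniform d hd) (i : Fin d) : q i = 1 / d := by
  have h1 := congrFun (congrArg Subtype.val h) ((sortPerm q).symm i)
  rw [sortVec_apply] at h1
  simpa [uniform] using h1

/-- A diagonalization, in any order, gives one with the sorted positive eigenvalues. -/
theorem exists_isometry_of_diagonalization {α : Type} [Fintype α] {d : ℕ}
    (U : Matrix α (Fin d) ℂ) (hU : Uᴴ * U = 1) (q : stdSimplex ℝ (Fin d)) :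
    ∃ V : Matrix α (Fin (ProbVec.size (sortVec q))) ℂ, Vᴴ * V = 1 ∧
      V * (Matrix.diagonal fun i : Fin (ProbVec.size (sortVec q)) => ((sortVec q).1 i : ℂ)) * Vᴴ =
        U * (Matrix.diagonal fun i => ((q i : ℝ) : ℂ)) * Uᴴ := by
  have hle : ProbVec.size (sortVec q) ≤ d := Nat.sInf_le (sortVec_mem_probVecs q)
  -- `g` selects the columns with positive eigenvalue, in sorted order; the discarded columns carry
  -- weight zero.
  let g : Fin (ProbVec.size (sortVec q)) → Fin d := fun i => sortPerm q (Fin.castLE hle i)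
  have hg : Function.Injective g := (sortPerm q).injective.comp (Fin.castLE_injective hle)
  have hqg : ∀ i : Fin (ProbVec.size (sortVec q)), (sortVec q).1 i = q (g i) := fun i => by
    rw [sortVec_apply, dif_pos (i.2.trans_le hle)]
    rfl
  have hq0 : ∀ k, k ∉ Set.range g → q k = 0 := by
    intro k hk
    have h1 : (sortVec q).1 ((sortPerm q).symm k) = q k := by
      rw [sortVec_apply, dif_pos ((sortPerm q).symm k).2]
      simp
    rw [← h1]
    refine ProbVec.eq_zero_of_size_le _ (not_lt.mp fun h => hk ⟨⟨_, h⟩, ?_⟩)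
    simp [g]
  refine ⟨U.submatrix id g, ?_, ?_⟩
  · have : (U.submatrix id g)ᴴ * U.submatrix id g = (Uᴴ * U).submatrix g g := by
      rw [Matrix.conjTranspose_submatrix, Matrix.submatrix_mul _ _ _ id _ Function.bijective_id]
    rw [this, hU, Matrix.submatrix_one _ hg]
  · ext a a'
    rw [Matrix.mul_apply, Matrix.mul_apply]
    simp only [Matrix.mul_diagonal, Matrix.submatrix_apply, id, Matrix.conjTranspose_apply, hqg]
    rw [← Finset.sum_image (f := fun k => U a k * ((q k : ℝ) : ℂ) * star (U a' k))
      (s := Finset.univ) (g := g) (fun i _ j _ h => hg h)]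
    refine Finset.sum_subset (Finset.subset_univ _) fun k _ hk => ?_
    rw [hq0 k (by simpa using hk)]
    simp

/-- The state with the eigenvectors and eigenvalues given by `U` and `q`. -/
def diagState {α : Type} [Fintype α] {d : ℕ} (U : Matrix α (Fin d) ℂ) (hU : Uᴴ * U = 1)
    (q : stdSimplex ℝ (Fin d)) : State α :=
  State.ofTrace (U * (Matrix.diagonal fun i => ((q i : ℝ) : ℂ)) * Uᴴ)
    (Matrix.PosSemidef.mul_mul_conjTranspose_same
      (Matrix.PosSemidef.diagonal fun i => Complex.zero_le_real.mpr (q.2.1 i)) U)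
    (by
      rw [Matrix.trace_mul_comm, ← Matrix.mul_assoc, hU, Matrix.one_mul, Matrix.trace_diagonal,
        ← Complex.ofReal_sum]
      exact congrArg _ q.2.2)

theorem exists_eq_diagState {α : Type} [Fintype α] {d : ℕ} (hd : Fintype.card α = d)
    (σ : State α) : ∃ (U : Matrix α (Fin d) ℂ) (hU : Uᴴ * U = 1) (q : stdSimplex ℝ (Fin d)),
      σ = diagState U hU q := by
  classical
  have hH := σ.posSemidef.isHermitian
  let e : Fin d ≃ α := (Fintype.equivFinOfCardEq hd).symm
  let W : Matrix α α ℂ := hH.eigenvectorUnitary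
  have hW : Wᴴ * W = 1 := Unitary.coe_star_mul_self hH.eigenvectorUnitary
  have hU : (W.submatrix id e)ᴴ * W.submatrix id e = 1 := by
    rw [Matrix.conjTranspose_submatrix, ← Matrix.submatrix_mul _ _ _ id _ Function.bijective_id, hW,
      Matrix.submatrix_one _ e.injective]
  have hsp : σ.mat = W * (Matrix.diagonal fun i => (hH.eigenvalues i : ℂ)) * Wᴴ := by
    have := hH.spectral_theorem
    rw [Unitary.conjStarAlgAut_apply] at this
    exact this
  refine ⟨W.submatrix id e, hU, ⟨fun i => hH.eigenvalues (e i), fun i =>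
    σ.posSemidef.eigenvalues_nonneg _, ?_⟩, ?_⟩
  · have h := hH.trace_eq_sum_eigenvalues
    rw [σ.trace_eq] at h
    rw [Equiv.sum_comp e (fun a => hH.eigenvalues a)]
    have h' := congrArg Complex.re h
    simpa using h'.symm
  · apply State.ext
    refine hsp.trans ?_
    ext a a'
    simp only [diagState, State.ofTrace]
    rw [Matrix.mul_apply, Matrix.mul_apply]
    simp only [Matrix.mul_diagonal, Matrix.submatrix_apply, id, Matrix.conjTranspose_apply]
    exact (Equiv.sum_comp e fun k => W a k * (hH.eigenvalues k : ℂ) * star (W a' k)).symm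

/-! ### Local operations on pure states -/

theorem mul_pureMat_mul {α R α' R' : Type} [Fintype α] [Fintype R] (G : Matrix α R ℂ)
    (G' : Matrix α' R' ℂ) (L : Matrix (α' × R') (α × R) ℂ)
    (h : ∀ x, ∑ y, L x y * G y.1 y.2 = G' x.1 x.2) : L * pureMat G * Lᴴ = pureMat G' := by
  have h' : L *ᵥ (fun y => G y.1 y.2) = fun x => G' x.1 x.2 := funext h
  rw [pureMat, Matrix.mul_vecMulVec, Matrix.vecMulVec_mul, Matrix.vecMul_conjTranspose, star_star,
    h', pureMat]

theorem kronecker_one_mul_pureMat {m n l : ℕ} (K : Matrix (Fin l) (Fin m) ℂ)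
    (G : Matrix (Fin m) (Fin n) ℂ) :
    (K ⊗ₖ (1 : Matrix (Fin n) (Fin n) ℂ)) * pureMat G * (K ⊗ₖ (1 : Matrix (Fin n) (Fin n) ℂ))ᴴ =
      pureMat (K * G) := by
  refine mul_pureMat_mul _ _ _ fun x => ?_
  rw [Fintype.sum_prod_type]
  simp [Matrix.mul_apply, Matrix.kroneckerMap_apply, Matrix.one_apply]

theorem one_kronecker_mul_pureMat {m n l : ℕ} (K : Matrix (Fin l) (Fin n) ℂ)
    (G : Matrix (Fin m) (Fin n) ℂ) :
    ((1 : Matrix (Fin m) (Fin m) ℂ) ⊗ₖ K) * pureMat G * ((1 : Matrix (Fin m) (Fin m) ℂ) ⊗ₖ K)ᴴ =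
      pureMat (G * Kᵀ) := by
  refine mul_pureMat_mul _ _ _ fun x => ?_
  rw [Fintype.sum_prod_type]
  simp [Matrix.mul_apply, Matrix.kroneckerMap_apply, Matrix.one_apply, mul_comm]

/-- A measurement by the second party, followed by a unitary correction by the first one. -/
theorem IsEntanglementMonotone.le_of_measure_correct {E : ∀ m n : ℕ, State (Fin m × Fin n) → ℝ}
    (hE : IsEntanglementMonotone E) {m n l : ℕ} {J : Type} [Fintype J]
    (K : J → Matrix (Fin l) (Fin n) ℂ) (hK : ∑ j, (K j)ᴴ * K j = 1)
    (U : J → Matrix (Fin m) (Fin m) ℂ) (hU : ∀ j, (U j)ᴴ * U j = 1)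
    (G : Matrix (Fin m) (Fin n) ℂ) (ρ : State (Fin m × Fin n)) (hρ : ρ.mat = pureMat G)
    (ρ' : State (Fin m × Fin l)) (hρ' : ρ'.mat = ∑ j, pureMat (U j * (G * (K j)ᵀ))) :
    E m l ρ' ≤ E m n ρ := by
  let e := Fintype.equivFin J
  have hK' : ∑ i, (K (e.symm i))ᴴ * K (e.symm i) = 1 := by
    rw [Equiv.sum_comp e.symm (fun j => (K j)ᴴ * K j), hK]
  -- The correction is a round of the first party with a single outcome.
  refine hE.locc m n m l _ (IsLOCC.second (fun i => K (e.symm i)) hK' _ fun i =>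
    IsLOCC.first (k := 1) (fun _ => U (e.symm i)) (by simp [hU]) _ fun _ => IsLOCC.done) ρ ρ' ?_
  simp only [hρ, one_kronecker_mul_pureMat, kronecker_one_mul_pureMat, Finset.univ_unique,
    Finset.sum_const, Finset.card_singleton, one_smul]
  rw [hρ', Equiv.sum_comp e.symm (fun j => pureMat (U j * (G * (K j)ᵀ)))]

/-! ### The Weyl operators -/

/-- The discrete Weyl operators. -/
def weyl (d : ℕ) [NeZero d] (j : ZMod d × ZMod d) : Matrix (ZMod d) (ZMod d) ℂ :=
  fun x y => if x = y + j.1 then ZMod.stdAddChar (j.2 * y) else 0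

theorem weyl_conj_apply (d : ℕ) [NeZero d] (j : ZMod d × ZMod d)
    (M : Matrix (ZMod d) (ZMod d) ℂ) (y y' : ZMod d) :
    ((weyl d j)ᴴ * M * weyl d j) y y' =
      ZMod.stdAddChar (j.2 * (y' - y)) * M (y + j.1) (y' + j.1) := by
  have hstar : star (ZMod.stdAddChar (j.2 * y) : ℂ) = ZMod.stdAddChar (-(j.2 * y)) := by
    rw [AddChar.map_neg_eq_conj]
    rfl
  simp only [Matrix.mul_apply, Matrix.conjTranspose_apply, weyl, apply_ite star, star_zero,
    ite_mul, zero_mul, mul_ite, mul_zero, Finset.sum_ite_eq', Finset.mem_univ, if_true, hstar]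
  rw [mul_sub, sub_eq_neg_add, AddChar.map_add_eq_mul]
  ring

theorem weyl_isometry (d : ℕ) [NeZero d] (j : ZMod d × ZMod d) : (weyl d j)ᴴ * weyl d j = 1 := by
  ext y y'
  have h := weyl_conj_apply d j 1 y y'
  rw [Matrix.mul_one] at h
  rw [h, Matrix.one_apply, Matrix.one_apply]
  by_cases hy : y = y'
  · simp [hy]
  · simp [hy]

/-- The character sum over the phases kills the off-diagonal entries and gives a factor `d` on the
diagonal; the sum over the shifts then turns each diagonal entry into the trace. -/
theorem weyl_twirl (d : ℕ) [NeZero d] (M : Matrix (ZMod d) (ZMod d) ℂ) :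
    ∑ j, (weyl d j)ᴴ * M * weyl d j = ((d : ℂ) * M.trace) • 1 := by
  ext y y'
  rw [Matrix.sum_apply, Fintype.sum_prod_type]
  simp only [weyl_conj_apply, ← Finset.sum_mul,
    AddChar.sum_mulShift _ (ZMod.isPrimitive_stdAddChar d), sub_eq_zero]
  rw [Matrix.smul_apply, Matrix.one_apply]
  by_cases hy : y = y'
  · subst hy
    simp only [if_true, ← Finset.mul_sum, ZMod.card, smul_eq_mul, mul_one, Matrix.trace,
      Matrix.diag_apply]
    rw [← Equiv.sum_comp (Equiv.addLeft y) fun x => M x x]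
    rfl
  · simp [hy, Ne.symm hy]

/-- There are unitary matrices that depolarize completely. -/
theorem exists_twirl (d : ℕ) (hd : 0 < d) :
    ∃ U : Fin d × Fin d → Matrix (Fin d) (Fin d) ℂ, (∀ j, (U j)ᴴ * U j = 1) ∧
      ∀ M, ∑ j, (U j)ᴴ * M * U j = ((d : ℂ) * M.trace) • 1 := by
  have : NeZero d := ⟨hd.ne'⟩
  let e : Fin d ≃ ZMod d := (ZMod.finEquiv d).toEquiv
  refine ⟨fun j => (weyl d (e j.1, e j.2)).submatrix e e, fun j => ?_, fun M => ?_⟩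
  · rw [Matrix.conjTranspose_submatrix, Matrix.submatrix_mul_equiv, weyl_isometry,
      Matrix.submatrix_one_equiv]
  · have h := weyl_twirl d (M.submatrix e.symm e.symm)
    have htr : (M.submatrix e.symm e.symm).trace = M.trace :=
      Equiv.sum_comp e.symm fun x => M x x
    rw [htr] at h
    have h2 := congrArg (fun N => N.submatrix e e) h
    simp only [Matrix.submatrix_smul, Pi.smul_apply, Matrix.submatrix_one_equiv] at h2
    rw [← h2, ← Equiv.sum_comp (Equiv.prodCongr e e)]
    ext x y
    simp only [Matrix.sum_apply, Matrix.submatrix_apply]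
    refine Finset.sum_congr rfl fun j _ => ?_
    have : M = (M.submatrix e.symm e.symm).submatrix e e := by simp
    conv_lhs => rw [this, Matrix.conjTranspose_submatrix, Matrix.submatrix_mul_equiv,
      Matrix.submatrix_mul_equiv]
    rfl

/-! ### Maximally entangled states -/

theorem exists_sum_pureMat {m n : ℕ} (σ : State (Fin m × Fin n)) :
    ∃ X : Fin (m * n) → Matrix (Fin m) (Fin n) ℂ, σ.mat = ∑ z, pureMat (X z) := by
  obtain ⟨U, hU, q, rfl⟩ := exists_eq_diagState (d := m * n) (by simp) σ
  refine ⟨fun z a b => (Real.sqrt (q z) : ℂ) * U (a, b) z, ?_⟩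
  ext x y
  change (U * (Matrix.diagonal fun i => ((q i : ℝ) : ℂ)) * Uᴴ) x y = _
  rw [Matrix.mul_apply, Matrix.sum_apply]
  refine Finset.sum_congr rfl fun z _ => ?_
  simp only [Matrix.mul_diagonal, Matrix.conjTranspose_apply]
  have h : ((q z : ℝ) : ℂ) = (Real.sqrt (q z) : ℂ) * star (Real.sqrt (q z) : ℂ) := by
    rw [Complex.star_def, Complex.conj_ofReal, ← Complex.ofReal_mul, Real.mul_self_sqrt]
    exact q.2.1 z
  rw [h]
  change _ = (Real.sqrt (q z) : ℂ) * U x z * star ((Real.sqrt (q z) : ℂ) * U y z)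
  rw [star_mul']
  ring

theorem star_inv_sqrt_natCast (d : ℕ) :
    star (((Real.sqrt d)⁻¹ : ℝ) : ℂ) = (((Real.sqrt d)⁻¹ : ℝ) : ℂ) := Complex.conj_ofReal _

theorem inv_sqrt_natCast_mul_self (d : ℕ) :
    (((Real.sqrt d)⁻¹ : ℝ) : ℂ) * (((Real.sqrt d)⁻¹ : ℝ) : ℂ) = (d : ℂ)⁻¹ := by
  rw [← Complex.ofReal_mul, ← mul_inv, Real.mul_self_sqrt (Nat.cast_nonneg d)]
  simp

/-- The matrix of the components of the maximally entangled vector. -/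
def maxEntMat (d : ℕ) {n : ℕ} (V : Matrix (Fin n) (Fin d) ℂ) : Matrix (Fin d) (Fin n) ℂ :=
  (((Real.sqrt d)⁻¹ : ℝ) : ℂ) • Vᵀ

theorem trace_maxEntMat {d n : ℕ} (hd : 0 < d) {V : Matrix (Fin n) (Fin d) ℂ}
    (hV : Vᴴ * V = 1) : (maxEntMat d V * (maxEntMat d V)ᴴ).trace = 1 := by
  have h1 : Vᵀ * (Vᵀ)ᴴ = 1 := by
    rw [show (Vᵀ)ᴴ = (Vᴴ)ᵀ from rfl, ← Matrix.transpose_mul, hV, Matrix.transpose_one]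
  rw [maxEntMat, Matrix.conjTranspose_smul, Matrix.smul_mul, Matrix.mul_smul, smul_smul, h1,
    star_inv_sqrt_natCast, inv_sqrt_natCast_mul_self, Matrix.trace_smul, Matrix.trace_one,
    Fintype.card_fin, smul_eq_mul, inv_mul_cancel₀]
  exact_mod_cast hd.ne'

section
variable {E : ∀ m n : ℕ, State (Fin m × Fin n) → ℝ}

/-- Write `σ` as a sum of `|X z⟩⟨X z|`. The second party measures with `(c (U j)ᴴ X z)ᵀ`, where `c =
1/√d`, and the first party applies `U j`. The factors `U j` cancel, leaving `X z / d` for each of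
the `d²` values of `j`, which together restore `|X z⟩⟨X z|`. The twirl gives completeness of the
measurement. -/
theorem IsEntanglementMonotone.le_maxEnt (hE : IsEntanglementMonotone E) {d n : ℕ} (hd : 0 < d)
    (Φ : State (Fin d × Fin d)) (hΦ : Φ.mat = pureMat (maxEntMat d 1)) (σ : State (Fin d × Fin n)) :
    E d n σ ≤ E d d Φ := by
  obtain ⟨U, hU, htw⟩ := exists_twirl d hd
  obtain ⟨X, hX⟩ := exists_sum_pureMat σ
  have hd0 : (d : ℂ) ≠ 0 := by exact_mod_cast hd.ne'
  have hUU : ∀ j, U j * (U j)ᴴ = 1 := fun j => mul_eq_one_comm.mp (hU j)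
  have hYY : ∀ Y : Matrix (Fin d) (Fin n) ℂ, (Yᵀ)ᴴ * Yᵀ = (Y * Yᴴ)ᵀ := fun Y => by
    rw [Matrix.transpose_mul]
    rfl
  set c : ℂ := (((Real.sqrt d)⁻¹ : ℝ) : ℂ) with hc
  have hcc : c * c = (d : ℂ)⁻¹ := inv_sqrt_natCast_mul_self d
  have hcs : star c = c := star_inv_sqrt_natCast d
  have htr : (∑ z, X z * (X z)ᴴ).trace = 1 := by
    rw [Matrix.trace_sum, ← σ.trace_eq, hX, Matrix.trace_sum]
    exact Finset.sum_congr rfl fun z _ => (trace_pureMat _).symm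
  refine hE.le_of_measure_correct (J := (Fin d × Fin d) × Fin (d * n))
    (fun j => (c • ((U j.1)ᴴ * X j.2))ᵀ) ?_ (fun j => U j.1) (fun j => hU j.1) _ Φ hΦ σ ?_
  · have h1 : ∀ j : (Fin d × Fin d) × Fin (d * n),
        ((c • ((U j.1)ᴴ * X j.2))ᵀ)ᴴ * (c • ((U j.1)ᴴ * X j.2))ᵀ =
          ((d : ℂ)⁻¹ • ((U j.1)ᴴ * (X j.2 * (X j.2)ᴴ) * U j.1))ᵀ := by
      intro j
      rw [hYY, Matrix.conjTranspose_smul, Matrix.smul_mul, Matrix.mul_smul, smul_smul, hcs, hcc,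
        Matrix.conjTranspose_mul, Matrix.conjTranspose_conjTranspose]
      simp only [Matrix.mul_assoc]
    simp only [h1]
    rw [Fintype.sum_prod_type, ← Matrix.transpose_one, ← (show
      (d : ℂ)⁻¹ • ∑ j, (U j)ᴴ * (∑ z, X z * (X z)ᴴ) * U j = 1 by
        rw [htw, htr, mul_one, smul_smul, inv_mul_cancel₀ hd0, one_smul])]
    simp only [Finset.smul_sum, Matrix.transpose_sum, Finset.mul_sum, Finset.sum_mul]
  · rw [hX, Fintype.sum_prod_type, Finset.sum_comm]
    refine Finset.sum_congr rfl fun z _ => ?_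
    have h1 : ∀ j : Fin d × Fin d, U j * ((maxEntMat d 1 : Matrix (Fin d) (Fin d) ℂ) *
        ((c • ((U j)ᴴ * X z))ᵀ)ᵀ) = (d : ℂ)⁻¹ • X z := by
      intro j
      rw [maxEntMat, ← hc, Matrix.transpose_transpose, Matrix.transpose_one, Matrix.smul_mul,
        Matrix.one_mul, smul_smul, hcc, Matrix.mul_smul, ← Matrix.mul_assoc, hUU, Matrix.one_mul]
    simp only [h1]
    ext x y
    simp only [Finset.sum_const, Finset.card_univ, Fintype.card_prod, Fintype.card_fin,
      Matrix.smul_apply, pureMat_apply, smul_eq_mul, star_mul', star_inv₀, star_natCast,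
      nsmul_eq_mul, Nat.cast_mul]
    field_simp

theorem IsEntanglementMonotone.maxEnt_le (hE : IsEntanglementMonotone E) {d n : ℕ} (hd : 0 < d)
    (Φ : State (Fin d × Fin d)) (hΦ : Φ.mat = pureMat (maxEntMat d 1))
    {V : Matrix (Fin n) (Fin d) ℂ} (hV : Vᴴ * V = 1) (Ψ : State (Fin d × Fin n))
    (hΨ : Ψ.mat = pureMat (maxEntMat d V)) : E d d Φ ≤ E d n Ψ := by
  refine hE.le_of_measure_correct (undoKraus V ⟨0, hd⟩) (sum_undoKraus hV _) (fun _ => 1)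
    (fun _ => by simp) _ Ψ hΨ Φ ?_
  have h : ∀ j, (1 : Matrix (Fin d) (Fin d) ℂ) * (maxEntMat d V * (undoKraus V ⟨0, hd⟩ j)ᵀ) =
      maxEntMat d (undoKraus V ⟨0, hd⟩ j * V) := by
    intro j
    rw [Matrix.one_mul, maxEntMat, maxEntMat, Matrix.smul_mul, ← Matrix.transpose_mul]
  simp only [h]
  rw [Fintype.sum_option, undoKraus_none_mul hV, hΦ, Finset.sum_eq_zero, add_zero]
  intro a _
  rw [undoKraus_some_mul hV]
  ext x y
  simp [maxEntMat, pureMat_apply]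

/-- The maximum is already the value at the `d₁ × d₁` maximally entangled state; for larger `d₂` an
isometric embedding of the second system attains it by a pure state. -/
theorem IsEntanglementMonotone.exists_isGreatest (hE : IsEntanglementMonotone E) {d₁ : ℕ}
    (hd : 0 < d₁) : ∃ e : ℝ, ∀ d₂, d₁ ≤ d₂ →
      IsGreatest {y | ∃ σ : State (Fin d₁ × Fin d₂), σ.IsPure ∧ E d₁ d₂ σ = y} e ∧
      IsGreatest (Set.range (E d₁ d₂)) e := by
  let Φ : State (Fin d₁ × Fin d₁) := pureState (maxEntMat d₁ 1) (trace_maxEntMat hd (by simp))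
  have hle : ∀ {n : ℕ} (σ : State (Fin d₁ × Fin n)), E d₁ n σ ≤ E d₁ d₁ Φ := fun σ =>
    hE.le_maxEnt hd Φ rfl σ
  refine ⟨E d₁ d₁ Φ, fun d₂ h => ?_⟩
  let V : Matrix (Fin d₂) (Fin d₁) ℂ := (1 : Matrix (Fin d₂) (Fin d₂) ℂ).submatrix id (Fin.castLE h)
  have hV : Vᴴ * V = 1 := by
    rw [Matrix.conjTranspose_submatrix, ← Matrix.submatrix_mul _ _ _ id _ Function.bijective_id,
      Matrix.conjTranspose_one, Matrix.mul_one, Matrix.submatrix_one _ (Fin.castLE_injective h)]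
  let Ψ : State (Fin d₁ × Fin d₂) := pureState (maxEntMat d₁ V) (trace_maxEntMat hd hV)
  have hΨ : E d₁ d₂ Ψ = E d₁ d₁ Φ := le_antisymm (hle Ψ) (hE.maxEnt_le hd Φ rfl hV Ψ rfl)
  refine ⟨⟨⟨Ψ, ⟨_, rfl⟩, hΨ⟩, ?_⟩, ⟨⟨Ψ, hΨ⟩, ?_⟩⟩
  · rintro _ ⟨σ, -, rfl⟩
    exact hle σ
  · rintro _ ⟨σ, rfl⟩
    exact hle σ

end

/-! ### Convexity -/

/-- A convex function does not decrease on at least one of the segments to the vertices of the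
simplex. -/
theorem exists_vertex_le {d : ℕ} {g : (Fin d → ℝ) → ℝ} (hg : ConvexOn ℝ (stdSimplex ℝ (Fin d)) g)
    {q : Fin d → ℝ} (hq : q ∈ stdSimplex ℝ (Fin d)) :
    ∃ i, ∀ t : ℝ, 0 ≤ t → t ≤ 1 → g q ≤ g ((1 - t) • q + t • Pi.single i 1) := by
  by_contra! h
  choose t ht0 ht1 ht using h
  have hpos : ∀ i, 0 < t i := fun i => lt_of_le_of_ne (ht0 i) fun h0 => by
    have := ht i
    rw [← h0] at this
    simp at this
  -- Weights proportional to `q i / t i` make `q` the barycenter of the chosen points of the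
  -- segments. Jensen's inequality then contradicts the strict decrease at all of them.
  set S : ℝ := ∑ i, q i / t i with hS
  have hS1 : 1 ≤ S := by
    rw [← hq.2]
    refine Finset.sum_le_sum fun i _ => ?_
    rw [le_div_iff₀ (hpos i)]
    exact mul_le_of_le_one_right (hq.1 i) (ht1 i)
  have hS0 : 0 < S := by linarith
  set w : Fin d → ℝ := fun i => q i / t i / S with hw
  have hw0 : ∀ i, 0 ≤ w i := fun i => div_nonneg (div_nonneg (hq.1 i) (ht0 i)) hS0.le
  have hw1 : ∑ i, w i = 1 := by
    rw [hw, ← Finset.sum_div, ← hS, div_self hS0.ne']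
  have hmem : ∀ i, (1 - t i) • q + t i • Pi.single i 1 ∈ stdSimplex ℝ (Fin d) := fun i =>
    convex_stdSimplex ℝ (Fin d) hq (single_mem_stdSimplex ℝ i) (sub_nonneg.mpr (ht1 i)) (ht0 i)
      (by ring)
  have hsum : ∑ i, w i • ((1 - t i) • q + t i • Pi.single i 1) = q := by
    ext k
    simp only [Finset.sum_apply, Pi.smul_apply, Pi.add_apply, smul_eq_mul, Pi.single_apply,
      mul_add, mul_ite, mul_one, mul_zero, Finset.sum_add_distrib, Finset.sum_ite_eq,
      Finset.mem_univ, if_true]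
    have h1 : ∀ i, w i * ((1 - t i) * q k) = w i * q k - q i * (q k / S) := by
      intro i
      have := (hpos i).ne'
      simp only [hw]
      field_simp
    simp only [h1, Finset.sum_sub_distrib, ← Finset.sum_mul, hw1, hq.2]
    have h2 : w k * t k = q k / S := by
      have := (hpos k).ne'
      simp only [hw]
      field_simp
    rw [h2]
    ring
  have h1 := hg.map_sum_le (t := Finset.univ) (fun i _ => hw0 i) hw1 (fun i _ => hmem i)
  rw [hsum] at h1
  have hex : ∃ i, 0 < w i := by
    by_contra! hn
    have := Finset.sum_nonpos fun i (_ : i ∈ Finset.univ) => hn i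
    linarith
  obtain ⟨i, hi⟩ := hex
  have h2 : ∑ i, w i • g ((1 - t i) • q + t i • Pi.single i 1) < ∑ i, w i * g q :=
    Finset.sum_lt_sum (fun j _ => mul_le_mul_of_nonneg_left (ht j).le (hw0 j))
      ⟨i, Finset.mem_univ i, mul_lt_mul_of_pos_left (ht i) hi⟩
  rw [← Finset.sum_mul, hw1, one_mul] at h2
  linarith

/-- For a fixed eigenbasis the state is affine in its eigenvalues. The value `0` off the simplex
plays no role. -/
theorem IsConvexMeasure.convexOn {E : ∀ m n : ℕ, State (Fin m × Fin n) → ℝ}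
    (hE : IsConvexMeasure E) {m n d : ℕ} (U : Matrix (Fin m × Fin n) (Fin d) ℂ)
    (hU : Uᴴ * U = 1) : ConvexOn ℝ (stdSimplex ℝ (Fin d))
      (fun q => open Classical in
        if h : q ∈ stdSimplex ℝ (Fin d) then E m n (diagState U hU ⟨q, h⟩) else 0) := by
  refine ⟨convex_stdSimplex ℝ (Fin d), fun q hq r hr a b ha hb hab => ?_⟩
  have hqr := convex_stdSimplex ℝ (Fin d) hq hr ha hb hab
  obtain rfl : b = 1 - a := by linarith
  simp only [dif_pos hq, dif_pos hr, dif_pos hqr, smul_eq_mul]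
  refine hE m n _ _ _ a ha (by linarith) ?_
  change U * (Matrix.diagonal fun i => (((a • q + (1 - a) • r) i : ℝ) : ℂ)) * Uᴴ =
    (a : ℂ) • (U * (Matrix.diagonal fun i => ((q i : ℝ) : ℂ)) * Uᴴ) +
      ((1 - a : ℝ) : ℂ) • (U * (Matrix.diagonal fun i => ((r i : ℝ) : ℂ)) * Uᴴ)
  have hs : ∀ (z : ℂ) (D : Matrix (Fin d) (Fin d) ℂ), z • (U * D * Uᴴ) = U * (z • D) * Uᴴ :=
    fun z D => by rw [Matrix.mul_smul, Matrix.smul_mul]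
  rw [hs, hs, ← Matrix.add_mul, ← Matrix.mul_add]
  congr 2
  ext i j
  by_cases hij : i = j
  · subst hij
    simp
  · simp [Matrix.diagonal_apply_ne _ hij]

/-- The point `(1 - t) q + t e_i` of the simplex. -/
def vertexPath {d : ℕ} (q : stdSimplex ℝ (Fin d)) (i : Fin d) (t : unitInterval) :
    stdSimplex ℝ (Fin d) :=
  ⟨(1 - (t : ℝ)) • q.1 + (t : ℝ) • Pi.single i 1,
    convex_stdSimplex ℝ (Fin d) q.2 (single_mem_stdSimplex ℝ i) (sub_nonneg.mpr t.2.2) t.2.1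
      (by ring)⟩

theorem continuous_vertexPath {d : ℕ} (q : stdSimplex ℝ (Fin d)) (i : Fin d) :
    Continuous (vertexPath q i) := by
  refine Continuous.subtype_mk ?_ _
  fun_prop

section
variable {P : Type → Prop} {C : ∀ α κ : Type, State (α × κ) → ℝ}
  {E : ∀ m n : ℕ, State (Fin m × Fin n) → ℝ}

/-- The correlation can be lowered to any value without lowering the entanglement. -/
theorem exists_le_and_pureStateFunction_eq (hC : IsCorrelationMonotone P C)
    (hP : ∀ κ : Type, Finite κ → P κ) (hE : IsConvexMeasure E) {m n d : ℕ}
    (hf : ContinuousOn (pureStateFunction C) (probVecs d))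
    (U : Matrix (Fin m × Fin n) (Fin d) ℂ) (hU : Uᴴ * U = 1) (q : stdSimplex ℝ (Fin d)) {x : ℝ}
    (hx0 : 0 ≤ x) (hx : x ≤ pureStateFunction C (sortVec q)) :
    ∃ r : stdSimplex ℝ (Fin d), pureStateFunction C (sortVec r) = x ∧
      E m n (diagState U hU q) ≤ E m n (diagState U hU r) := by
  -- Move towards the eigenprojection `i`: `E` stays above its initial value, while `f` runs
  -- continuously from at least `x` to `0`.
  obtain ⟨i, hi⟩ := exists_vertex_le (hE.convexOn U hU) q.2
  have hcont : Continuous fun t => pureStateFunction C (sortVec (vertexPath q i t)) :=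
    (hf.comp_continuous (continuous_sortVec d) sortVec_mem_probVecs).comp
      (continuous_vertexPath q i)
  have h0 : vertexPath q i 0 = q := Subtype.ext (by simp [vertexPath])
  have h1 : pureStateFunction C (sortVec (vertexPath q i 1)) = 0 := by
    refine hC.pureStateFunction_eq_zero hP _ (sortVec_single i fun j hj => ?_)
    change ((1 - ((1 : unitInterval) : ℝ)) • q.1 +
      ((1 : unitInterval) : ℝ) • Pi.single i 1 : Fin d → ℝ) j = 0
    simp [hj]
  obtain ⟨t, ht⟩ := mem_range_of_exists_le_of_exists_ge hcont (c := x) ⟨1, h1.le.trans hx0⟩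
    ⟨0, by rwa [h0]⟩
  refine ⟨vertexPath q i t, ht, ?_⟩
  have h := hi t t.2.1 t.2.2
  have hmem : (1 - (t : ℝ)) • q.1 + (t : ℝ) • Pi.single i 1 ∈ stdSimplex ℝ (Fin d) :=
    (vertexPath q i t).2
  rwa [dif_pos q.2, dif_pos hmem] at h

/-! ### Marginals and correlation -/

theorem IsCorrelationMonotone.exists_diagState_reduceA (hC : IsCorrelationMonotone P C)
    (hP : ∀ κ : Type, Finite κ → P κ) {α κ : Type} [Fintype α] [DecidableEq α] (hκ : P κ) {d : ℕ}
    (hd : Fintype.card α = d) (ρ : State (α × κ)) :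
    ∃ (U : Matrix α (Fin d) ℂ) (hU : Uᴴ * U = 1) (q : stdSimplex ℝ (Fin d)),
      ρ.reduceA = diagState U hU q ∧ C α κ ρ ≤ pureStateFunction C (sortVec q) := by
  obtain ⟨U, hU, q, h⟩ := exists_eq_diagState hd ρ.reduceA
  obtain ⟨V, hV, hVU⟩ := exists_isometry_of_diagonalization U hU q
  refine ⟨U, hU, q, h, hC.le_pureStateFunction hP hκ _ V hV ρ ?_⟩
  rw [h, hVU]
  rfl

/-- A purification whose reference system has the dimension of the rank attains the bound on the
correlation given the marginal. -/
theorem IsCorrelationMonotone.exists_reduceA_eq_diagState (hC : IsCorrelationMonotone P C)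
    (hP : ∀ κ : Type, Finite κ → P κ) {α : Type} [Fintype α] [DecidableEq α] {d : ℕ}
    (U : Matrix α (Fin d) ℂ) (hU : Uᴴ * U = 1) (q : stdSimplex ℝ (Fin d)) :
    ∃ κ : Type, P κ ∧ ∃ ρ : State (α × κ),
      C α κ ρ = pureStateFunction C (sortVec q) ∧ ρ.reduceA = diagState U hU q := by
  obtain ⟨V, hV, hVU⟩ := exists_isometry_of_diagonalization U hU q
  have hG := (isometry_diag_mul_conjTranspose (sortVec q) V).trans hVU
  have htr := (congrArg Matrix.trace hG).trans (diagState U hU q).trace_eq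
  exact ⟨_, hP _ inferInstance, pureState _ htr, hC.pure_eq hP _ V hV _ rfl,
    State.ext ((reduceA_pureState _ htr).trans hG)⟩

theorem isSeparable_of_mat_eq {m n : ℕ} (hm : 0 < m) (hn : 0 < n) (ρ : State (Fin m × Fin n))
    (h : ρ.mat = ((m * n : ℕ) : ℂ)⁻¹ • 1) : IsSeparable ρ := by
  have hs : ∀ k : ℕ, 0 < k → ∃ σ : State (Fin k), σ.mat = (k : ℂ)⁻¹ • 1 := fun k hk =>
    ⟨State.ofTrace ((k : ℂ)⁻¹ • 1) (Matrix.PosSemidef.one.smul (by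
      rw [← Complex.ofReal_natCast, ← Complex.ofReal_inv, Complex.zero_le_real]
      positivity)) (by
      rw [Matrix.trace_smul, Matrix.trace_one, Fintype.card_fin, smul_eq_mul, inv_mul_cancel₀]
      exact_mod_cast hk.ne'), rfl⟩
  obtain ⟨σ, hσ⟩ := hs m hm
  obtain ⟨τ, hτ⟩ := hs n hn
  refine ⟨1, fun _ => 1, fun _ => σ, fun _ => τ, fun _ => zero_le_one, by simp, ?_⟩
  simp only [h, hσ, hτ]
  rw [Matrix.smul_kronecker, Matrix.kronecker_smul, Matrix.one_kronecker_one, smul_smul]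
  simp [mul_comm, smul_smul]

end

end QCorr

end

/-! ### The tradeoff function -/

theorem mainTheorem1
    (P : Type → Prop) (hPfin : ∀ κ : Type, Finite κ → P κ)
    (hPprod : ∀ κ κ' : Type, P κ → P κ' → P (κ × κ'))
    (E : ∀ m n : ℕ, QCorr.State (Fin m × Fin n) → ℝ)
    (hE : QCorr.IsEntanglementMonotone E) (hEconv : QCorr.IsConvexMeasure E)
    (C : ∀ α κ : Type, QCorr.State (α × κ) → ℝ)
    (hC : QCorr.IsCorrelationMonotone P C) :
    ∃ e : ℕ → ℝ,
      (∀ d₁ d₂ : ℕ, 0 < d₁ → d₁ ≤ d₂ →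
        IsGreatest {y | ∃ σ : QCorr.State (Fin d₁ × Fin d₂), σ.IsPure ∧ E d₁ d₂ σ = y} (e d₁) ∧
        IsGreatest (Set.range (E d₁ d₂)) (e d₁)) ∧
      ∀ (d₁ d₂ : ℕ) (h₁ : 0 < d₁) (h₂ : d₁ ≤ d₂),
        ContinuousOn (QCorr.pureStateFunction C) (QCorr.probVecs (d₁ * d₂)) →
        ∃ ξ : ℝ → ℝ,
          AntitoneOn ξ (Set.Icc 0 (QCorr.maxCorrelation C (d₁ * d₂))) ∧
          ξ 0 = e d₁ ∧
          (∀ κ : Type, P κ → ∀ ρ : QCorr.State ((Fin d₁ × Fin d₂) × κ),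
            C (Fin d₁ × Fin d₂) κ ρ ∈ Set.Icc 0 (QCorr.maxCorrelation C (d₁ * d₂)) ∧
            E d₁ d₂ ρ.reduceA ≤ ξ (C (Fin d₁ × Fin d₂) κ ρ)) ∧
          (∀ x ∈ Set.Icc 0 (QCorr.maxCorrelation C (d₁ * d₂)), ∀ η : ℝ, 0 < η →
            ∃ κ : Type, P κ ∧ ∃ ρ : QCorr.State ((Fin d₁ × Fin d₂) × κ),
              C (Fin d₁ × Fin d₂) κ ρ = x ∧
              ξ (C (Fin d₁ × Fin d₂) κ ρ) - E d₁ d₂ ρ.reduceA < η) ∧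
          (QCorr.pureStateFunction C
                (QCorr.uniform (d₁ * d₂) (Nat.mul_pos h₁ (h₁.trans_le h₂))) =
              QCorr.maxCorrelation C (d₁ * d₂) →
            (∀ p ∈ QCorr.probVecs (d₁ * d₂),
              p ≠ QCorr.uniform (d₁ * d₂) (Nat.mul_pos h₁ (h₁.trans_le h₂)) →
              QCorr.pureStateFunction C p < QCorr.maxCorrelation C (d₁ * d₂)) →
            ξ (QCorr.maxCorrelation C (d₁ * d₂)) = 0) := by
  have hex : ∀ d₁ : ℕ, ∃ e : ℝ, 0 < d₁ → ∀ d₂, d₁ ≤ d₂ →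
      IsGreatest {y | ∃ σ : QCorr.State (Fin d₁ × Fin d₂), σ.IsPure ∧ E d₁ d₂ σ = y} e ∧
      IsGreatest (Set.range (E d₁ d₂)) e := by
    intro d₁
    rcases Nat.eq_zero_or_pos d₁ with h | h
    -- Nothing is claimed for `d₁ = 0`, so the value is arbitrary.
    · exact ⟨0, fun h' => absurd h' (by omega)⟩
    · obtain ⟨e, he⟩ := hE.exists_isGreatest h
      exact ⟨e, fun _ => he⟩
  choose e he using hex
  refine ⟨e, fun d₁ d₂ h₁ h₂ => he d₁ h₁ d₂ h₂, fun d₁ d₂ h₁ h₂ hf => ?_⟩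
  have hE' := (he d₁ h₁ d₂ h₂).2
  have hcard : Fintype.card (Fin d₁ × Fin d₂) = d₁ * d₂ := by simp
  have hpos : 0 < d₁ * d₂ := Nat.mul_pos h₁ (h₁.trans_le h₂)
  set c := QCorr.maxCorrelation C (d₁ * d₂) with hc
  -- The constraint is `x ≤ f` rather than equality: the sets shrink as `x` grows, so monotonicity
  -- is immediate, and convexity of `E` later recovers equality.
  let S : ℝ → Set ℝ := fun x =>
    {y | ∃ (U : Matrix (Fin d₁ × Fin d₂) (Fin (d₁ * d₂)) ℂ) (hU : U.conjTranspose * U = 1)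
      (q : stdSimplex ℝ (Fin (d₁ * d₂))),
        x ≤ QCorr.pureStateFunction C (QCorr.sortVec q) ∧
          E d₁ d₂ (QCorr.diagState U hU q) = y}
  obtain ⟨ξ, hS⟩ : ∃ ξ : ℝ → ℝ, ∀ x, ξ x = sSup (S x) := ⟨_, fun _ => rfl⟩
  have hbdd : ∀ x, BddAbove (S x) := by
    refine fun x => ⟨e d₁, ?_⟩
    rintro _ ⟨U, hU, q, -, rfl⟩
    exact hE'.2 ⟨_, rfl⟩
  have hfbdd := ((QCorr.isCompact_probVecs (d₁ * d₂)).image_of_continuousOn hf).bddAbove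
  have hfle : ∀ q : stdSimplex ℝ (Fin (d₁ * d₂)),
      QCorr.pureStateFunction C (QCorr.sortVec q) ≤ c := fun q =>
    le_csSup hfbdd ⟨_, QCorr.sortVec_mem_probVecs q, rfl⟩
  have hne : ∀ x ≤ c, (S x).Nonempty := by
    intro x hx
    obtain ⟨p, hp, hpc⟩ := ((QCorr.isCompact_probVecs (d₁ * d₂)).image_of_continuousOn hf).sSup_mem
      ⟨_, QCorr.uniform (d₁ * d₂) hpos, fun i hi => if_neg hi.not_gt, rfl⟩
    rw [← QCorr.range_sortVec] at hp
    obtain ⟨q, rfl⟩ := hp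
    obtain ⟨σ, hσ⟩ := hE'.1
    -- Any orthonormal basis will do; `σ` only serves to supply one.
    obtain ⟨U, hU, -, -⟩ := QCorr.exists_eq_diagState hcard σ
    exact ⟨_, U, hU, q, hx.trans hpc.ge, rfl⟩
  refine ⟨ξ, ?_, ?_, ?_, ?_, ?_⟩
  · intro x _ y hy hxy
    rw [hS, hS]
    refine csSup_le_csSup (hbdd x) (hne y hy.2) ?_
    rintro _ ⟨U, hU, q, hq, rfl⟩
    exact ⟨U, hU, q, hxy.trans hq, rfl⟩
  · rw [hS]
    refine IsGreatest.csSup_eq ⟨?_, ?_⟩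
    -- At `x = 0` the constraint is void, because `f` is the correlation of a purification and so is
    -- nonnegative.
    · obtain ⟨σ, hσ⟩ := hE'.1
      obtain ⟨U, hU, q, rfl⟩ := QCorr.exists_eq_diagState hcard σ
      obtain ⟨κ, hκ, ρ, hρ, -⟩ := hC.exists_reduceA_eq_diagState hPfin U hU q
      exact ⟨U, hU, q, hρ ▸ hC.nonneg _ _ hκ ρ, hσ⟩
    · rintro _ ⟨U, hU, q, -, rfl⟩
      exact hE'.2 ⟨_, rfl⟩
  · intro κ hκ ρ
    obtain ⟨U, hU, q, hρ, hle⟩ := hC.exists_diagState_reduceA hPfin hκ hcard ρ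
    refine ⟨⟨hC.nonneg _ _ hκ ρ, hle.trans (hfle q)⟩, ?_⟩
    rw [hS]
    exact le_csSup (hbdd _) ⟨U, hU, q, hle, by rw [hρ]⟩
  · intro x hx η hη
    obtain ⟨_, ⟨U, hU, q, hq, rfl⟩, hlt⟩ := exists_lt_of_lt_csSup (hne x hx.2)
      (sub_lt_self (sSup (S x)) hη)
    obtain ⟨r, hr, hqr⟩ :=
      QCorr.exists_le_and_pureStateFunction_eq hC hPfin hEconv hf U hU q hx.1 hq
    obtain ⟨κ, hκ, ρ, hρ, hρA⟩ := hC.exists_reduceA_eq_diagState hPfin U hU r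
    refine ⟨κ, hκ, ρ, hρ.trans hr, ?_⟩
    rw [hρ, hr, hρA, hS]
    linarith
  · intro _ huniq
    have hzero : ∀ y ∈ S c, y = 0 := by
      rintro _ ⟨U, hU, q, hq, rfl⟩
      -- Membership in `S c` forces the uniform spectrum, so the state is a multiple of `U Uᴴ`,
      -- which is the identity because `U` is square.
      have hu : QCorr.sortVec q = QCorr.uniform (d₁ * d₂) hpos := by
        by_contra h
        exact absurd hq (huniq _ (QCorr.sortVec_mem_probVecs q) h).not_ge
      refine hE.separable _ _ _ (QCorr.isSeparable_of_mat_eq h₁ (h₁.trans_le h₂) _ ?_)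
      have hUU : U * U.conjTranspose = 1 :=
        (Matrix.mul_eq_one_comm_of_card_eq _ _ _ (by simp)).mp hU
      change U * (Matrix.diagonal fun i => ((q i : ℝ) : ℂ)) * U.conjTranspose = _
      have hdiag : (Matrix.diagonal fun i => ((q i : ℝ) : ℂ)) = ((d₁ * d₂ : ℕ) : ℂ)⁻¹ • 1 := by
        rw [← Matrix.diagonal_one, ← Matrix.diagonal_smul]
        congr 1
        ext i
        rw [QCorr.sortVec_eq_uniform hpos hu i]
        simp
      rw [hdiag, Matrix.mul_smul, Matrix.mul_one, Matrix.smul_mul, hUU]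
    rw [hS, Set.eq_singleton_iff_nonempty_unique_mem.mpr ⟨hne c le_rfl, hzero⟩, csSup_singleton]
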